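/- Let $\Gamma=\mathrm{SL}_2(\mathbb{Z})$. For an even integer $k$ let $S_k(\Gamma)$ be the space of holomorphic cusp forms of weight $k$ for $\Gamma$, with the Petersson inner product $\langle f,g\rangle=\int_{\Gamma\backslash\mathbb{H}}\overline{f(z)}\,g(z)\,y^k\,\frac{dx\,dy}{y^2}$ (the measure $dx\,dy/y^2$ not normalized). For an orthonormal basis $\mathcal{B}_k$ of $S_k(\Gamma)$ and a real number $x$, let $\mu_k^\times$ be the measure on $\mathbb{R}^+=(0,\infty)$ given by $$d\mu_k^\times=\frac{1}{|\mathcal{B}_k|}\sum_{f\in\mathcal{B}_k}y^k|f(x+iy)|^2\,\frac{dy}{y}.$$ There are absolute positive constants $A_0,Y_0,k_0,C$ such that the following holds for all real $A\ge A_0$ and $Y\ge Y_0$, all even integers $k\ge k_0$, every orthonormal basis $\mathcal{B}_k$ of $S_k(\Gamma)$, and every $x\in\mathbb{R}$. If $\psi:\mathbb{R}^+\to\mathbb{C}$ is smooth and compactly supported with $$\operatorname{supp}\psi\subset\bigl(Y^{-1},\,k^{1/2}(17A\log k)^{-1/2}\bigr),$$ then $$\left|\int_{\mathbb{R}^+}\psi(y)\,d\mu_k^\times(y)-\frac{3}{\pi}\int_{\mathbb{R}^+}\psi(y)\,\frac{dy}{y}\right|\le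 C\,\|\psi\|_\infty\,Y^2\,k^{-1/2}(\log k)^{1/2}.$$ -/

import Mathlib

open scoped MatrixGroups ContDiff

noncomputable section

/-- The Petersson inner product `∫_{SL(2,ℤ)\ℍ} conj (f z) g z y^k dx dy / y²` on cusp forms of
weight `k` for `SL(2,ℤ)`. It is an integral over the standard fundamental domain, and
`MeasureTheory.volume` on the upper half-plane is the hyperbolic measure `dx dy / y²`
(not normalized: the fundamental domain has volume `π / 3`). -/
def peterssonInner (k : ℕ) (f g : CuspForm 𝒮ℒ (k : ℤ)) : ℂ :=
  ∫ z in ModularGroup.fd, UpperHalfPlane.petersson (k : ℤ) f g z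

/-- A basis of the space of cusp forms of weight `k` for `SL(2,ℤ)` that is orthonormal for the
Petersson inner product. -/
def IsPeterssonOrthonormal {k : ℕ} {ι : Type*}
    (B : Module.Basis ι ℂ (CuspForm 𝒮ℒ (k : ℤ))) : Prop :=
  (∀ i, peterssonInner k (B i) (B i) = 1) ∧
    ∀ i j, i ≠ j → peterssonInner k (B i) (B j) = 0

/-- The density `|B|⁻¹ ∑_{f ∈ B} y^k |f(x + iy)|²`, meaningful for `y > 0`. -/
def averagedDensity {k : ℕ} {ι : Type*} [Fintype ι]
    (B : Module.Basis ι ℂ (CuspForm 𝒮ℒ (k : ℤ))) (x y : ℝ) : ℝ :=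
  (Fintype.card ι : ℝ)⁻¹ *
    ∑ i, y ^ k * ‖B i (UpperHalfPlane.ofComplex ((x : ℂ) + (y : ℂ) * Complex.I))‖ ^ 2

/-- The measure `dy / y` on `(0, ∞)`, as a measure on `ℝ`. -/
def multiplicativeMeasure : MeasureTheory.Measure ℝ :=
  (MeasureTheory.volume.restrict (Set.Ioi (0 : ℝ))).withDensity fun y => ENNReal.ofReal (1 / y)

/-- The averaged measure `|B|⁻¹ ∑_{f ∈ B} y^k |f(x + iy)|² dy / y` on the vertical geodesic over
`x`, as a measure on `ℝ` carried by `(0, ∞)`. -/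
def averagedVerticalMeasure {k : ℕ} {ι : Type*} [Fintype ι]
    (B : Module.Basis ι ℂ (CuspForm 𝒮ℒ (k : ℤ))) (x : ℝ) : MeasureTheory.Measure ℝ :=
  multiplicativeMeasure.withDensity fun y => ENNReal.ofReal (averagedDensity B x y)

end

/-! ### Mean value property on the disc with a radial weight -/

section

open MeasureTheory Set Metric

/-! Write k = 2m. The density at z = x + iy is, up to normalization, the diagonal of the reproducing
kernel of the space of cusp forms, and for large k that kernel is dominated by the terms g = ±1 of a
sum over SL₂(ℤ).

The Bergman kernel (2i/(z - w̄))^k reproduces holomorphic f with |f|² y^k bounded: move w to the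
centre of the disc and apply the mean value property (`integral_halfPlane_bergman`). Its translates
under SL₂(ℤ) sum to a cusp form, and unfolding shows that pairing with it is evaluation at w times
8π/(k - 1). Expanding it in an orthonormal basis gives the pretrace formula `kernelSeries_diag_eq`:
(8π/(k - 1)) y^k ∑|f(z)|² is a sum over g of terms of modulus P_g^(-m), where P_g = cosh²(d(z,
gz)/2) is `displacement`. The terms g = ±1 contribute 2. Since the dimension is k/12 + O(1), they
yield 3/π with error O(1/k).

It remains to bound the integral of ∑ P_g^(-m) dy/y over g ≠ ±1. Let c be the lower-left entry. If c
≠ 0, three factors of P_g make the sum over g converge and the others give 1/(1 + K(P_g - 1)) with K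
= m - 3. For |trace| ≥ 2 this saves K^(-1/2) pointwise. For |trace| ≤ 1 the line may pass close to
the fixed point of g, and the saving appears only after integration, as the width of a Lorentzian
peak. Both cases cost Y². If c = 0, g is a translation, which moves z little only when y is large;
the cutoff y < (k/(34 log k))^(1/2) is what makes P_g^(-m) small. The total is O(Y² k^(-1/2)),
without the factor (log k)^(1/2). -/

theorem integral_circle_of_differentiableOn {F : ℂ → ℂ} (hF : DifferentiableOn ℂ F (ball 0 1))
    {r : ℝ} (h0 : 0 < r) (h1 : r < 1) :
    ∫ θ in Ioo (-Real.pi) Real.pi, F (r * (Real.cos θ + Real.sin θ * Complex.I)) =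
      2 * Real.pi * F 0 := by
  have hd : DiffContOnCl ℂ F (ball 0 |r|) := by
    refine ⟨hF.mono (ball_subset_ball (by rw [abs_of_pos h0]; exact h1.le)), ?_⟩
    refine hF.continuousOn.mono ?_
    rw [closure_ball _ (by positivity), abs_of_pos h0]
    exact closedBall_subset_ball h1
  have h := hd.circleAverage
  rw [Real.circleAverage_eq_integral_add (-Real.pi),
    intervalIntegral.integral_comp_add_right (fun θ ↦ F (circleMap 0 r θ))] at h
  rw [← integral_Ioc_eq_integral_Ioo, ← intervalIntegral.integral_of_le
    (by linarith [Real.pi_pos])]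
  have e : ∀ θ : ℝ, circleMap 0 r θ = r * (Real.cos θ + Real.sin θ * Complex.I) := by
    intro θ
    simp [circleMap, Complex.exp_mul_I]
  simp only [e] at h
  rw [show (0 : ℝ) + -Real.pi = -Real.pi by ring,
    show 2 * Real.pi + -Real.pi = Real.pi by ring] at h
  rw [← h, Complex.real_smul]
  have : (Real.pi : ℂ) ≠ 0 := by exact_mod_cast Real.pi_ne_zero
  simp only [Complex.ofReal_inv, Complex.ofReal_mul, Complex.ofReal_ofNat]
  rw [← mul_assoc, mul_inv_cancel₀ (mul_ne_zero two_ne_zero this), one_mul]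

theorem integral_mul_one_sub_sq_pow (n : ℕ) :
    ∫ r in Ioo (0 : ℝ) 1, r * (1 - r ^ 2) ^ n = 1 / (2 * ((n : ℝ) + 1)) := by
  rw [← integral_Ioc_eq_integral_Ioo, ← intervalIntegral.integral_of_le zero_le_one]
  have hd : ∀ r ∈ uIcc (0 : ℝ) 1,
      HasDerivAt (fun r : ℝ ↦ -(1 - r ^ 2) ^ (n + 1) / (2 * (n + 1))) (r * (1 - r ^ 2) ^ n) r := by
    intro r _
    have h := ((((hasDerivAt_id' r).pow 2).const_sub 1).pow (n + 1)).neg.div_const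
      (2 * ((n : ℝ) + 1))
    refine h.congr_deriv ?_
    have : (n : ℝ) + 1 ≠ 0 := by positivity
    push_cast
    field_simp
    simp [mul_comm]
  rw [intervalIntegral.integral_eq_sub_of_hasDerivAt hd
    (Continuous.intervalIntegrable (by fun_prop) _ _)]
  simp only [one_pow, sub_self, ne_eq, Nat.add_eq_zero_iff, one_ne_zero, and_false,
    not_false_eq_true, zero_pow, neg_zero, zero_div, OfNat.ofNat_ne_zero, sub_zero]
  ring

theorem continuousOn_weighted_of_differentiableOn {F : ℂ → ℂ}
    (hF : DifferentiableOn ℂ F (ball 0 1)) (n : ℕ) :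
    ContinuousOn (fun ζ : ℂ ↦ F ζ * ((1 - ‖ζ‖ ^ 2 : ℝ) : ℂ) ^ n) (ball 0 1) :=
  hF.continuousOn.mul (by fun_prop)

/-- The weight is radial, so in polar coordinates the mean value property replaces F by F 0 on each
circle. The bound M serves only to justify Fubini. -/
theorem integral_ball_weighted {F : ℂ → ℂ} (hF : DifferentiableOn ℂ F (ball 0 1)) (n : ℕ)
    {M : ℝ} (hM : ∀ ζ ∈ ball (0 : ℂ) 1, ‖F ζ * ((1 - ‖ζ‖ ^ 2 : ℝ) : ℂ) ^ n‖ ≤ M) :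
    ∫ ζ in ball (0 : ℂ) 1, F ζ * ((1 - ‖ζ‖ ^ 2 : ℝ) : ℂ) ^ n = Real.pi / (n + 1) * F 0 := by
  set G : ℂ → ℂ := fun ζ ↦ F ζ * ((1 - ‖ζ‖ ^ 2 : ℝ) : ℂ) ^ n with hG
  set e : ℝ × ℝ → ℂ := fun p ↦ p.1 * (Real.cos p.2 + Real.sin p.2 * Complex.I) with he
  have hnorm : ∀ p, ‖e p‖ = |p.1| := fun p ↦ by
    rw [← Complex.norm_polarCoord_symm, Complex.polarCoord_symm_apply]
  have hcont : Continuous e := by fun_prop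
  rw [← integral_indicator measurableSet_ball, ← Complex.integral_comp_polarCoord_symm]
  have h1 : ∫ p in polarCoord.target, p.1 • (ball (0 : ℂ) 1).indicator G
        (Complex.polarCoord.symm p) =
      ∫ p in polarCoord.target, (Iio (1 : ℝ) ×ˢ (univ : Set ℝ)).indicator
        (fun p ↦ p.1 • G (e p)) p := by
    refine setIntegral_congr_fun polarCoord.open_target.measurableSet fun p hp ↦ ?_
    have hp1 : 0 < p.1 := hp.1
    simp only [indicator, Complex.polarCoord_symm_apply, mem_ball_zero_iff]
    change p.1 • (if ‖e p‖ < 1 then G (e p) else 0) = _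
    rw [hnorm, abs_of_pos hp1]
    simp
  rw [h1, setIntegral_indicator (measurableSet_Iio.prod MeasurableSet.univ), polarCoord_target,
    prod_inter_prod, inter_univ, Ioi_inter_Iio]
  have hmaps : MapsTo e (Ioo 0 1 ×ˢ Ioo (-Real.pi) Real.pi) (ball 0 1) := by
    intro p hp
    rw [mem_ball_zero_iff, hnorm, abs_of_pos hp.1.1]
    exact hp.1.2
  have hS : MeasurableSet (Ioo (0 : ℝ) 1 ×ˢ Ioo (-Real.pi) Real.pi) :=
    measurableSet_Ioo.prod measurableSet_Ioo
  have hint : IntegrableOn (fun p : ℝ × ℝ ↦ p.1 • G (e p))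
      (Ioo 0 1 ×ˢ Ioo (-Real.pi) Real.pi) := by
    refine IntegrableOn.of_bound ?_ ?_ M ?_
    · rw [Measure.volume_eq_prod, Measure.prod_prod]
      exact ENNReal.mul_lt_top (by simp) (by simp)
    · have hc : ContinuousOn (fun p : ℝ × ℝ ↦ p.1 • G (e p))
          (Ioo 0 1 ×ˢ Ioo (-Real.pi) Real.pi) :=
        continuous_fst.continuousOn.smul ((continuousOn_weighted_of_differentiableOn hF n).comp
        hcont.continuousOn hmaps)
      exact hc.aestronglyMeasurable hS
    · refine (ae_restrict_iff' hS).mpr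
        (Filter.Eventually.of_forall fun p hp ↦ ?_)
      rw [norm_smul, Real.norm_of_nonneg hp.1.1.le]
      calc p.1 * ‖G (e p)‖ ≤ 1 * ‖G (e p)‖ := by gcongr; exact hp.1.2.le
        _ ≤ M := by rw [one_mul]; exact hM _ (hmaps hp)
  rw [Measure.volume_eq_prod] at hint ⊢
  rw [setIntegral_prod _ hint]
  have h2 : ∀ r ∈ Ioo (0 : ℝ) 1, ∫ θ in Ioo (-Real.pi) Real.pi, r • G (e (r, θ)) =
      ((r * (1 - r ^ 2) ^ n : ℝ) : ℂ) * (2 * Real.pi * F 0) := by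
    intro r hr
    rw [integral_smul]
    have : ∀ θ, G (e (r, θ)) = F (r * (Real.cos θ + Real.sin θ * Complex.I)) *
        ((1 - r ^ 2 : ℝ) : ℂ) ^ n := fun θ ↦ by
      simp only [hG, hnorm, sq_abs]; rfl
    simp only [this]
    rw [integral_mul_const, integral_circle_of_differentiableOn hF hr.1 hr.2, Complex.real_smul]
    push_cast
    ring
  rw [setIntegral_congr_fun measurableSet_Ioo h2, integral_mul_const, integral_complex_ofReal,
    integral_mul_one_sub_sq_pow]
  have : (n : ℂ) + 1 ≠ 0 := by exact_mod_cast n.succ_ne_zero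
  push_cast
  field_simp

end

/-! ### Cayley transform and the Bergman reproducing formula -/

section

open MeasureTheory Set Metric
open scoped ComplexConjugate

/-- The Cayley map from the unit disc to the upper half-plane sending `0` to `w`. -/
noncomputable def discToHalfPlane (w ζ : ℂ) : ℂ := (w - conj w * ζ) / (1 - ζ)

theorem one_sub_ne_zero_of_mem_ball {ζ : ℂ} (hζ : ζ ∈ ball (0 : ℂ) 1) : 1 - ζ ≠ 0 := by
  intro h
  rw [← sub_eq_zero.mp h] at hζ
  simp at hζ

theorem one_sub_norm_sq_pos_of_mem_ball {ζ : ℂ} (hζ : ζ ∈ ball (0 : ℂ) 1) : 0 < 1 - ‖ζ‖ ^ 2 := by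
  rw [mem_ball_zero_iff] at hζ
  nlinarith [norm_nonneg ζ]

theorem sub_conj_eq_two_im_mul_I (w : ℂ) : w - conj w = 2 * w.im * Complex.I := by
  rw [Complex.sub_conj]; push_cast; ring

theorem discToHalfPlane_sub_conj (w : ℂ) {ζ : ℂ} (hζ : ζ ∈ ball (0 : ℂ) 1) :
    discToHalfPlane w ζ - conj w = 2 * w.im * Complex.I / (1 - ζ) := by
  have := one_sub_ne_zero_of_mem_ball hζ
  rw [← sub_conj_eq_two_im_mul_I, discToHalfPlane]
  field_simp
  ring

theorem discToHalfPlane_im (w : ℂ) {ζ : ℂ} (hζ : ζ ∈ ball (0 : ℂ) 1) :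
    (discToHalfPlane w ζ).im = w.im * (1 - ‖ζ‖ ^ 2) / ‖1 - ζ‖ ^ 2 := by
  have := one_sub_ne_zero_of_mem_ball hζ
  have h2 : Complex.normSq (1 - ζ) ≠ 0 := by simpa using this
  rw [discToHalfPlane, Complex.div_im, ← Complex.normSq_eq_norm_sq, ← Complex.normSq_eq_norm_sq]
  field_simp
  simp [Complex.normSq_apply]
  ring

theorem discToHalfPlane_im_pos {w : ℂ} (hw : 0 < w.im) {ζ : ℂ} (hζ : ζ ∈ ball (0 : ℂ) 1) :
    0 < (discToHalfPlane w ζ).im := by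
  rw [discToHalfPlane_im w hζ]
  have := one_sub_ne_zero_of_mem_ball hζ
  have := one_sub_norm_sq_pos_of_mem_ball hζ
  positivity

theorem hasDerivAt_discToHalfPlane (w : ℂ) {ζ : ℂ} (hζ : ζ ∈ ball (0 : ℂ) 1) :
    HasDerivAt (discToHalfPlane w) (2 * w.im * Complex.I / (1 - ζ) ^ 2) ζ := by
  have h0 := one_sub_ne_zero_of_mem_ball hζ
  have h := (((hasDerivAt_id' ζ).const_mul (conj w)).const_sub w).div
    ((hasDerivAt_id' ζ).const_sub 1) h0
  refine h.congr_deriv ?_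
  rw [← sub_conj_eq_two_im_mul_I]
  congr 1
  ring

theorem discToHalfPlane_injOn {w : ℂ} (hw : 0 < w.im) :
    InjOn (discToHalfPlane w) (ball 0 1) := by
  intro a ha b hb hab
  have h : discToHalfPlane w a - conj w = discToHalfPlane w b - conj w := by rw [hab]
  rw [discToHalfPlane_sub_conj w ha, discToHalfPlane_sub_conj w hb] at h
  have hw' : (2 * w.im * Complex.I : ℂ) ≠ 0 := by simp [hw.ne']
  have := one_sub_ne_zero_of_mem_ball ha
  have := one_sub_ne_zero_of_mem_ball hb
  rw [div_eq_div_iff ‹_› ‹_›] at h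
  have := mul_left_cancel₀ hw' h
  linear_combination this

theorem discToHalfPlane_image {w : ℂ} (hw : 0 < w.im) :
    discToHalfPlane w '' ball 0 1 = {z : ℂ | 0 < z.im} := by
  ext z
  constructor
  · rintro ⟨ζ, hζ, rfl⟩
    exact discToHalfPlane_im_pos hw hζ
  · intro hz
    have hz' : 0 < z.im := hz
    have h0 : z - conj w ≠ 0 := by
      intro h
      have := congrArg Complex.im h
      simp at this
      linarith
    have hw' : w - conj w ≠ 0 := by rw [sub_conj_eq_two_im_mul_I]; simp [hw.ne']
    refine ⟨(z - w) / (z - conj w), ?_, ?_⟩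
    · rw [mem_ball_zero_iff, norm_div, div_lt_one (norm_pos_iff.mpr h0)]
      refine lt_of_pow_lt_pow_left₀ 2 (norm_nonneg _) ?_
      rw [← Complex.normSq_eq_norm_sq, ← Complex.normSq_eq_norm_sq]
      simp only [Complex.normSq_apply, Complex.sub_re, Complex.sub_im, Complex.conj_re,
        Complex.conj_im]
      nlinarith [mul_pos hw hz']
    · rw [discToHalfPlane]
      have : 1 - (z - w) / (z - conj w) ≠ 0 := by
        rw [one_sub_div h0]
        refine div_ne_zero ?_ h0
        convert hw' using 1
        ring
      rw [div_eq_iff this]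
      field_simp
      ring

theorem abs_det_restrictScalars_toSpanSingleton (a : ℂ) :
    |((ContinuousLinearMap.toSpanSingleton ℂ a).restrictScalars ℝ).det| = ‖a‖ ^ 2 := by
  rw [ContinuousLinearMap.det, ContinuousLinearMap.coe_restrictScalars,
    LinearMap.det_restrictScalars]
  simp [Algebra.norm_complex_eq, Complex.normSq_eq_norm_sq]

section Reproducing

variable {w : ℂ} {n : ℕ} {f : ℂ → ℂ}

/-- The conjugated kernel supplies the (n+2)-th power of the conjugate of 1 - ζ, while weight and
Jacobian supply |1 - ζ|^(-2n-4). The antiholomorphic factors cancel, leaving a holomorphic function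
times a radial weight. -/
theorem bergman_integrand_discToHalfPlane (hw : 0 < w.im) (n : ℕ) (f : ℂ → ℂ)
    {ζ : ℂ} (hζ : ζ ∈ ball (0 : ℂ) 1) :
    ‖2 * w.im * Complex.I / (1 - ζ) ^ 2‖ ^ 2 •
      (conj ((2 * Complex.I / (discToHalfPlane w ζ - conj w)) ^ (n + 2)) *
        f (discToHalfPlane w ζ) * ((discToHalfPlane w ζ).im : ℂ) ^ n) =
    4 * (f (discToHalfPlane w ζ) / (1 - ζ) ^ (n + 2) * ((1 - ‖ζ‖ ^ 2 : ℝ) : ℂ) ^ n) := by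
  have h0 := one_sub_ne_zero_of_mem_ball hζ
  have hw0 : (w.im : ℂ) ≠ 0 := by exact_mod_cast hw.ne'
  have h1 : conj (1 - ζ) ≠ 0 := (map_ne_zero _).mpr h0
  have hI := Complex.I_ne_zero
  have e1 : 2 * Complex.I / (discToHalfPlane w ζ - conj w) = (1 - ζ) / w.im := by
    rw [discToHalfPlane_sub_conj w hζ]
    field_simp
  have e2 : ‖2 * w.im * Complex.I / (1 - ζ) ^ 2‖ ^ 2 = 4 * w.im ^ 2 / (‖1 - ζ‖ ^ 2) ^ 2 := by
    simp [div_pow, mul_pow]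
    ring
  have e3 : ((‖1 - ζ‖ ^ 2 : ℝ) : ℂ) = (1 - ζ) * conj (1 - ζ) := by
    rw [Complex.mul_conj, Complex.normSq_eq_norm_sq]
  rw [e1, e2, discToHalfPlane_im w hζ, Complex.real_smul, map_pow, map_div₀, Complex.conj_ofReal]
  rw [Complex.ofReal_div, Complex.ofReal_div, Complex.ofReal_pow, e3]
  push_cast
  rw [div_pow, div_pow, mul_pow, mul_pow, mul_pow]
  field_simp
  ring

theorem differentiableOn_comp_discToHalfPlane (hw : 0 < w.im)
    (hf : DifferentiableOn ℂ f {z | 0 < z.im}) (n : ℕ) :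
    DifferentiableOn ℂ (fun ζ ↦ f (discToHalfPlane w ζ) / (1 - ζ) ^ (n + 2)) (ball 0 1) := by
  refine DifferentiableOn.div ?_ (by fun_prop)
    fun ζ hζ ↦ pow_ne_zero _ (one_sub_ne_zero_of_mem_ball hζ)
  exact hf.comp (fun ζ hζ ↦ (hasDerivAt_discToHalfPlane w hζ).differentiableAt
    |>.differentiableWithinAt) fun ζ hζ ↦ discToHalfPlane_im_pos hw hζ

/-- After squaring there are 2n factors 1 - ‖ζ‖². The bound on f absorbs n + 2 of them; the
remaining n - 2 are at most 1, hence `2 ≤ n`. -/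
theorem exists_bound_comp_discToHalfPlane (hw : 0 < w.im) (hn : 2 ≤ n) {M : ℝ}
    (hM : ∀ z : ℂ, 0 < z.im → ‖f z‖ ^ 2 * z.im ^ (n + 2) ≤ M) :
    ∀ ζ ∈ ball (0 : ℂ) 1, ‖f (discToHalfPlane w ζ) / (1 - ζ) ^ (n + 2) *
      ((1 - ‖ζ‖ ^ 2 : ℝ) : ℂ) ^ n‖ ≤ Real.sqrt (M / w.im ^ (n + 2)) := by
  intro ζ hζ
  have h0 := one_sub_ne_zero_of_mem_ball hζ
  have h1 := one_sub_norm_sq_pos_of_mem_ball hζ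
  have h2 : 1 - ‖ζ‖ ^ 2 ≤ 1 := by nlinarith [sq_nonneg ‖ζ‖]
  refine Real.le_sqrt_of_sq_le ?_
  rw [le_div_iff₀ (by positivity)]
  refine le_trans ?_ (hM _ (discToHalfPlane_im_pos hw hζ))
  have h3 : 0 < ‖1 - ζ‖ := norm_pos_iff.mpr h0
  rw [discToHalfPlane_im w hζ, norm_mul, norm_div, norm_pow, norm_pow, Complex.norm_real,
    Real.norm_of_nonneg h1.le]
  obtain ⟨m, rfl⟩ := Nat.exists_eq_add_of_le hn
  have e : (‖f (discToHalfPlane w ζ)‖ / ‖1 - ζ‖ ^ (2 + m + 2) * (1 - ‖ζ‖ ^ 2) ^ (2 + m)) ^ 2 *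
      w.im ^ (2 + m + 2) = ‖f (discToHalfPlane w ζ)‖ ^ 2 *
      (w.im * (1 - ‖ζ‖ ^ 2) / ‖1 - ζ‖ ^ 2) ^ (2 + m + 2) * (1 - ‖ζ‖ ^ 2) ^ m := by
    generalize 1 - ‖ζ‖ ^ 2 = s
    rw [div_pow (w.im * s), mul_pow w.im s]
    field_simp
    ring
  rw [e]
  refine mul_le_of_le_one_right ?_ (pow_le_one₀ h1.le h2)
  positivity

/-- Applied with n = k - 2, because the measure dx dy / y² removes two powers of y. -/
theorem integral_halfPlane_bergman (hw : 0 < w.im) (hn : 2 ≤ n)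
    (hf : DifferentiableOn ℂ f {z | 0 < z.im}) {M : ℝ}
    (hM : ∀ z : ℂ, 0 < z.im → ‖f z‖ ^ 2 * z.im ^ (n + 2) ≤ M) :
    ∫ z in {z : ℂ | 0 < z.im}, conj ((2 * Complex.I / (z - conj w)) ^ (n + 2)) * f z *
      (z.im : ℂ) ^ n = 4 * Real.pi / (n + 1) * f w := by
  rw [← discToHalfPlane_image hw, integral_image_eq_integral_abs_det_fderiv_smul volume
    measurableSet_ball (fun ζ hζ ↦ ((hasDerivAt_discToHalfPlane w hζ).hasFDerivAt.restrictScalars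
      ℝ).hasFDerivWithinAt) (discToHalfPlane_injOn hw)]
  rw [setIntegral_congr_fun measurableSet_ball (g := fun ζ ↦ 4 *
    (f (discToHalfPlane w ζ) / (1 - ζ) ^ (n + 2) * ((1 - ‖ζ‖ ^ 2 : ℝ) : ℂ) ^ n))]
  · rw [integral_const_mul, integral_ball_weighted (differentiableOn_comp_discToHalfPlane hw hf n)
      n (exists_bound_comp_discToHalfPlane hw hn hM)]
    simp [discToHalfPlane]
    ring
  · intro ζ hζ
    simp only [abs_det_restrictScalars_toSpanSingleton]
    exact bergman_integrand_discToHalfPlane hw n f hζ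

theorem integrableOn_halfPlane_bergman (hw : 0 < w.im) (hn : 2 ≤ n)
    (hf : DifferentiableOn ℂ f {z | 0 < z.im}) {M : ℝ}
    (hM : ∀ z : ℂ, 0 < z.im → ‖f z‖ ^ 2 * z.im ^ (n + 2) ≤ M) :
    IntegrableOn (fun z : ℂ ↦ conj ((2 * Complex.I / (z - conj w)) ^ (n + 2)) * f z *
      (z.im : ℂ) ^ n) {z : ℂ | 0 < z.im} := by
  rw [← discToHalfPlane_image hw, integrableOn_image_iff_integrableOn_abs_det_fderiv_smul volume
    measurableSet_ball (fun ζ hζ ↦ ((hasDerivAt_discToHalfPlane w hζ).hasFDerivAt.restrictScalars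
      ℝ).hasFDerivWithinAt) (discToHalfPlane_injOn hw)]
  rw [integrableOn_congr_fun (g := fun ζ ↦ 4 * (f (discToHalfPlane w ζ) / (1 - ζ) ^ (n + 2) *
    ((1 - ‖ζ‖ ^ 2 : ℝ) : ℂ) ^ n)) _ measurableSet_ball]
  · refine Integrable.const_mul ?_ _
    refine IntegrableOn.of_bound measure_ball_lt_top ?_ (Real.sqrt (M / w.im ^ (n + 2))) ?_
    · exact (continuousOn_weighted_of_differentiableOn
        (differentiableOn_comp_discToHalfPlane hw hf n) n).aestronglyMeasurable measurableSet_ball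
    · exact (ae_restrict_iff' measurableSet_ball).mpr (Filter.Eventually.of_forall
        (exists_bound_comp_discToHalfPlane hw hn hM))
  · intro ζ hζ
    simp only [abs_det_restrictScalars_toSpanSingleton]
    exact bergman_integrand_discToHalfPlane hw n f hζ

end Reproducing

namespace UpperHalfPlane

theorem integral_eq_integral_complex (g : ℂ → ℂ) :
    ∫ τ : ℍ, g τ = ∫ z in {z : ℂ | 0 < z.im}, ((1 / z.im) ^ 2 : ℝ) • g z := by
  have hr : range UpperHalfPlane.coe = {z : ℂ | 0 < z.im} := range_coe
  rw [volume_def, integral_withDensity_eq_integral_smul (by fun_prop), ← hr,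
    ← measurableEmbedding_coe.map_comap, measurableEmbedding_coe.integral_map]
  rfl

theorem integrable_iff_integrableOn_complex (g : ℂ → ℂ) :
    Integrable (fun τ : ℍ ↦ g τ) ↔
      IntegrableOn (fun z ↦ ((1 / z.im) ^ 2 : ℝ) • g z) {z : ℂ | 0 < z.im} := by
  have hr : range UpperHalfPlane.coe = {z : ℂ | 0 < z.im} := range_coe
  rw [volume_def, integrable_withDensity_iff_integrable_smul (by fun_prop), IntegrableOn, ← hr,
    ← measurableEmbedding_coe.map_comap, measurableEmbedding_coe.integrable_map_iff]
  rfl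

end UpperHalfPlane

end

/-! ### Unfolding over SL₂(ℤ) -/

section

open MeasureTheory Set Metric
open scoped ComplexConjugate UpperHalfPlane Modular

namespace ModularGroup

theorem continuous_smul (g : SL(2, ℤ)) : Continuous fun z : ℍ ↦ g • z :=
  continuous_const_smul (g : GL (Fin 2) ℝ)

theorem measurePreserving_smul (g : SL(2, ℤ)) :
    MeasurePreserving (fun z : ℍ ↦ g • z) volume volume :=
  ⟨(continuous_smul g).measurable, by
    ext s hs
    rw [Measure.map_apply (continuous_smul g).measurable hs]
    exact MeasureTheory.measure_preimage_smul (volume : Measure ℍ) (g : GL (Fin 2) ℝ) s⟩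

/-- The boundary lies on the unit circle and two vertical lines, all Lebesgue null. -/
theorem volume_fd_diff_fdo : volume (𝒟 \ 𝒟ᵒ) = 0 := by
  rw [UpperHalfPlane.volume_eq_lintegral]
  refine setLIntegral_measure_zero _ _ (measure_mono_null (t := sphere 0 1 ∪
    (frontier {z : ℂ | z.re ≤ 1 / 2} ∪ frontier {z : ℂ | -(1 / 2) ≤ z.re})) ?_ ?_)
  · rintro _ ⟨z, ⟨⟨h1, h2⟩, h3⟩, rfl⟩
    rw [Complex.frontier_setOfPred_re_le, Complex.frontier_setOfPred_le_re]
    by_contra hz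
    simp only [mem_union, not_or, mem_sphere_iff_norm, sub_zero, mem_ofPred_eq] at hz
    obtain ⟨hz1, hz2, hz3⟩ := hz
    refine h3 ⟨lt_of_le_of_ne h1 fun h ↦ hz1 ?_, lt_of_le_of_ne h2 fun h ↦ ?_⟩
    · rw [Complex.normSq_eq_norm_sq] at h
      nlinarith [norm_nonneg (z : ℂ)]
    · rcases eq_or_eq_neg_of_abs_eq h with h | h
      · exact hz2 h
      · exact hz3 h
  · rw [measure_union_null_iff, measure_union_null_iff]
    refine ⟨Measure.addHaar_sphere _ _ _, ?_, ?_⟩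
    · exact (convex_halfSpace_re_le _).addHaar_frontier _
    · exact (convex_halfSpace_re_ge _).addHaar_frontier _

instance : Countable SL(2, ℤ) := by
  have : Countable (Matrix (Fin 2) (Fin 2) ℤ) := inferInstanceAs (Countable (Fin 2 → Fin 2 → ℤ))
  exact Subtype.countable

theorem measurableSet_fd : MeasurableSet 𝒟 := isClosed_fd.measurableSet

theorem ae_smul_notMem_fd_diff_fdo : ∀ᵐ z : ℍ, ∀ g : SL(2, ℤ), g • z ∉ 𝒟 \ 𝒟ᵒ := by
  rw [ae_all_iff]
  intro g
  refine measure_mono_null (t := (g • · : ℍ → ℍ) ⁻¹' (𝒟 \ 𝒟ᵒ)) (fun z hz ↦ by simpa using hz) ?_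
  exact (measurePreserving_smul g).quasiMeasurePreserving.preimage_null volume_fd_diff_fdo

/-- Off a null set the orbit avoids the boundary of 𝒟, so it meets 𝒟 in a single point, reached by g
and by -g. This is the source of the 2 in the unfolding. -/
theorem tsum_indicator_fd_smul : ∀ᵐ z : ℍ, ∑' g : SL(2, ℤ),
    fd.indicator (1 : ℍ → ENNReal) (g⁻¹ • z) = 2 := by
  filter_upwards [ae_smul_notMem_fd_diff_fdo] with z hz
  obtain ⟨g, hg⟩ := exists_smul_mem_fd z
  have hgo : g • z ∈ 𝒟ᵒ := by
    by_contra h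
    exact hz g ⟨hg, h⟩
  have hne : g⁻¹ ≠ -g⁻¹ := by
    intro h
    have h2 := congrArg (fun A : SL(2, ℤ) ↦ (A * g : SL(2, ℤ)) 0 0) h
    simp at h2
  have hmem : ∀ h : SL(2, ℤ), h⁻¹ • z ∈ 𝒟 → h = g⁻¹ ∨ h = -g⁻¹ := by
    intro h hh
    have : (h⁻¹ * g⁻¹) • (g • z) ∈ 𝒟 := by
      rwa [mul_smul, inv_smul_smul]
    rcases eq_one_or_neg_one_of_mem_fdo_mem_fd hgo this with h1 | h1
    · left
      exact inv_injective (by rw [mul_eq_one_iff_eq_inv.mp h1])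
    · right
      rw [mul_inv_eq_iff_eq_mul] at h1
      apply inv_injective
      rw [h1]
      exact eq_inv_of_mul_eq_one_left (by simp)
  rw [tsum_eq_sum (s := {g⁻¹, -g⁻¹})]
  · rw [Finset.sum_pair hne]
    have h1 : (-g⁻¹)⁻¹ = -g := inv_eq_of_mul_eq_one_left (by simp)
    have h2 : (-g) • z = g • z := SL_neg_smul g z
    rw [h1, h2, inv_inv, indicator_of_mem hg]
    norm_num
  · intro h hh
    refine indicator_of_notMem (fun h' ↦ hh ?_) _
    simpa using hmem h h'

theorem sum_map_smul_restrict_fd :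
    Measure.sum (fun g : SL(2, ℤ) ↦ (volume.restrict 𝒟).map (g • · : ℍ → ℍ)) =
      (2 : ENNReal) • (volume : Measure ℍ) := by
  ext s hs
  rw [Measure.sum_apply _ hs]
  have h : ∀ g : SL(2, ℤ), (volume.restrict 𝒟).map (g • · : ℍ → ℍ) s =
      ∫⁻ z in s, fd.indicator (1 : ℍ → ENNReal) (g⁻¹ • z) := by
    intro g
    have hm := (continuous_smul g).measurable hs
    rw [Measure.map_apply (continuous_smul g).measurable hs, Measure.restrict_apply hm,
      ← (measurePreserving_smul g⁻¹).measure_preimage (hm.inter measurableSet_fd).nullMeasurableSet]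
    have e : ∀ z : ℍ, fd.indicator (1 : ℍ → ENNReal) (g⁻¹ • z) =
        ((g⁻¹ • · : ℍ → ℍ) ⁻¹' 𝒟).indicator 1 z := fun z ↦ rfl
    simp only [e]
    rw [lintegral_indicator_one ((continuous_smul g⁻¹).measurable measurableSet_fd),
      Measure.restrict_apply ((continuous_smul g⁻¹).measurable measurableSet_fd), inter_comm]
    congr 1
    ext z
    simp only [mem_inter_iff, mem_preimage, smul_inv_smul]
  simp only [h]
  rw [← lintegral_tsum]
  · rw [lintegral_congr_ae (ae_restrict_of_ae tsum_indicator_fd_smul)]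
    simp
  · intro g
    exact ((measurable_one.indicator measurableSet_fd).comp
      (continuous_smul g⁻¹).measurable).aemeasurable

theorem hasSum_integral_fd_smul {E : Type*} [NormedAddCommGroup E] [NormedSpace ℝ E]
    {φ : ℍ → E} (hφ : Integrable φ) (hc : Continuous φ) :
    HasSum (fun g : SL(2, ℤ) ↦ ∫ z in 𝒟, φ (g • z)) ((2 : ℝ) • ∫ z, φ z) := by
  have hi : Integrable φ (Measure.sum fun g : SL(2, ℤ) ↦
      (volume.restrict 𝒟).map (g • · : ℍ → ℍ)) := by
    rw [sum_map_smul_restrict_fd]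
    exact hφ.smul_measure (by simp)
  have h := hasSum_integral_measure hi
  rw [sum_map_smul_restrict_fd, integral_smul_measure] at h
  convert! h using 1
  · ext g
    rw [integral_map (continuous_smul g).aemeasurable hc.aestronglyMeasurable]

theorem integrableOn_fd_smul {E : Type*} [NormedAddCommGroup E]
    {φ : ℍ → E} (hφ : Integrable φ) (g : SL(2, ℤ)) : IntegrableOn (fun z ↦ φ (g • z)) 𝒟 :=
  ((measurePreserving_smul g).integrable_comp_of_integrable hφ).integrableOn

theorem integral_fd_tsum_smul {E : Type*} [NormedAddCommGroup E] [NormedSpace ℝ E]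
    [CompleteSpace E] {φ : ℍ → E} (hφ : Integrable φ) (hc : Continuous φ) :
    ∫ z in 𝒟, ∑' g : SL(2, ℤ), φ (g • z) = (2 : ℝ) • ∫ z, φ z :=
  (hasSum_integral_of_summable_integral_norm (fun g ↦ integrableOn_fd_smul hφ g)
    (hasSum_integral_fd_smul hφ.norm hc.norm).summable).unique (hasSum_integral_fd_smul hφ hc)

end ModularGroup

end

/-! ### The series of translated Bergman kernels as a cusp form -/

section

open MeasureTheory Set Metric
open scoped ComplexConjugate UpperHalfPlane Modular ModularForm Manifold

/-- The weight `k` Bergman kernel `(2i / (z - conj w)) ^ k` of the upper half-plane. -/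
noncomputable def bergmanKernel (k : ℕ) (w : ℍ) (z : ℍ) : ℂ :=
  (2 * Complex.I / ((z : ℂ) - conj (w : ℂ))) ^ k

/-- The bilinear form `az + b - conj w (cz + d)` attached to the matrix `(a, b; c, d)`. -/
noncomputable def kernelDenom (g : SL(2, ℤ)) (w z : ℂ) : ℂ :=
  (g 0 0 : ℂ) * z + g 0 1 - conj w * ((g 1 0 : ℂ) * z + g 1 1)

theorem det_entries_eq_one (g : SL(2, ℤ)) : g 0 0 * g 1 1 - g 0 1 * g 1 0 = 1 := by
  rw [← Matrix.det_fin_two]; exact g.det_coe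

theorem denom_coe_eq (g : SL(2, ℤ)) (z : ℂ) :
    UpperHalfPlane.denom (g : GL (Fin 2) ℝ) z = (g 1 0 : ℂ) * z + g 1 1 := by
  simp [UpperHalfPlane.denom]

theorem bergmanKernel_slash (k : ℕ) (w z : ℍ) (g : SL(2, ℤ)) :
    (bergmanKernel k w ∣[(k : ℤ)] g) z = (2 * Complex.I / kernelDenom g w z) ^ k := by
  have hd := denom_coe_eq g z
  have h0 := UpperHalfPlane.denom_ne_zero (g : GL (Fin 2) ℝ) z
  rw [hd] at h0
  rw [ModularForm.SL_slash_apply, hd, bergmanKernel, zpow_neg, zpow_natCast, ← inv_pow, ← mul_pow,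
    UpperHalfPlane.coe_specialLinearGroup_apply, kernelDenom]
  congr 1
  simp only [algebraMap_int_eq, eq_intCast, Complex.ofReal_intCast]
  rw [← div_eq_mul_inv, div_div, sub_mul, div_mul_cancel₀ _ h0]

/-- Divided by `w.im * z.im` this reads 4 cosh²(d/2) = 2 cosh d + 2, with d the distance from w to
gz: the squares make 2 cosh d and the determinant supplies the 2. -/
theorem norm_kernelDenom_sq (g : SL(2, ℤ)) (w z : ℂ) :
    ‖kernelDenom g w z‖ ^ 2 =
      ((g 0 0 - g 1 0 * w.re) * z.re + (g 0 1 - g 1 1 * w.re)) ^ 2 + (w.im * g 1 0 * z.im) ^ 2 +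
        ((g 0 0 - g 1 0 * w.re) * z.im) ^ 2 + (w.im * (g 1 0 * z.re + g 1 1)) ^ 2 +
        2 * (w.im * z.im) := by
  have h : (g 0 0 * g 1 1 - g 0 1 * g 1 0 : ℝ) = 1 := by exact_mod_cast det_entries_eq_one g
  rw [← Complex.normSq_eq_norm_sq, Complex.normSq_apply]
  simp [kernelDenom]
  linear_combination (2 * w.im * z.im) * h

theorem two_mul_im_mul_im_le_norm_kernelDenom_sq (g : SL(2, ℤ)) (w z : ℂ) :
    2 * (w.im * z.im) ≤ ‖kernelDenom g w z‖ ^ 2 := by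
  rw [norm_kernelDenom_sq]
  linarith [sq_nonneg ((g 0 0 - g 1 0 * w.re) * z.re + (g 0 1 - g 1 1 * w.re)),
    sq_nonneg (w.im * g 1 0 * z.im), sq_nonneg ((g 0 0 - g 1 0 * w.re) * z.im),
    sq_nonneg (w.im * (g 1 0 * z.re + g 1 1))]

/-- Since `z.im` is bounded below, the squares in `norm_kernelDenom_sq` control c and the
combinations s, p, r; the other entries follow by triangular substitution. No upper bound on `z.im`
is needed, which later allows z to tend to the cusp. -/
theorem exists_entries_sq_le_norm_kernelDenom_sq {w : ℂ} (hw : 0 < w.im) {R : ℝ} (hR : 0 < R) :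
    ∃ C : ℝ, 0 < C ∧ ∀ (g : SL(2, ℤ)) (z : ℂ), |z.re| ≤ R → 1 / R ≤ z.im → ∀ i j,
      1 + (g i j : ℝ) ^ 2 ≤ C * ‖kernelDenom g w z‖ ^ 2 := by
  -- These constants serve 1, c², d², a², b², in this order.
  set C₀ : ℝ := R / (2 * w.im) with hC₀
  set C₁ : ℝ := R ^ 2 / w.im ^ 2 with hC₁
  set C₂ : ℝ := 2 / w.im ^ 2 + 2 * R ^ 2 * C₁ with hC₂
  set C₃ : ℝ := 2 * R ^ 2 + 2 * w.re ^ 2 * C₁ with hC₃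
  set C₄ : ℝ := 4 + 4 * R ^ 4 + 2 * w.re ^ 2 * C₂ with hC₄
  have h0 : 0 < C₀ := by positivity
  have h1 : 0 < C₁ := by positivity
  have h2 : 0 < C₂ := by positivity
  have h3 : 0 < C₃ := by positivity
  have h4 : 0 < C₄ := by positivity
  refine ⟨C₀ + C₁ + C₂ + C₃ + C₄, by positivity, fun g z hre him ↦ ?_⟩
  set D := ‖kernelDenom g w z‖ ^ 2 with hD
  have hD0 : 0 ≤ D := by positivity
  have hy : 0 < z.im := lt_of_lt_of_le (by positivity) him
  have hyR : 1 ≤ z.im * R := by rwa [div_le_iff₀ hR] at him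
  have hx2 : z.re ^ 2 ≤ R ^ 2 := sq_le_sq' (abs_le.mp hre).1 (abs_le.mp hre).2
  set s := (g 0 0 - g 1 0 * w.re) * z.re + (g 0 1 - g 1 1 * w.re) with hs
  set p := (g 0 0 - g 1 0 * w.re : ℝ) with hp
  set r := (g 1 0 * z.re + g 1 1 : ℝ) with hr
  have hDe : D = s ^ 2 + (w.im * g 1 0 * z.im) ^ 2 + (p * z.im) ^ 2 + (w.im * r) ^ 2 +
      2 * (w.im * z.im) := norm_kernelDenom_sq g w z
  have e0 : 0 < w.im * z.im := by positivity
  have e1 := sq_nonneg s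
  have e2 := sq_nonneg (w.im * g 1 0 * z.im)
  have e3 := sq_nonneg (p * z.im)
  have e4 := sq_nonneg (w.im * r)
  have b0 : 1 ≤ C₀ * D := by
    rw [hC₀, div_mul_eq_mul_div, le_div_iff₀ (by positivity)]
    calc 1 * (2 * w.im) = 2 * w.im * 1 := by ring
      _ ≤ 2 * w.im * (z.im * R) := by gcongr
      _ = R * (2 * (w.im * z.im)) := by ring
      _ ≤ R * D := by gcongr; linarith
  have hyR2 : 1 ≤ (z.im * R) ^ 2 := one_le_pow₀ hyR
  have bp : p ^ 2 ≤ R ^ 2 * D := by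
    calc p ^ 2 ≤ p ^ 2 * (z.im * R) ^ 2 := le_mul_of_one_le_right (sq_nonneg _) hyR2
      _ = R ^ 2 * (p * z.im) ^ 2 := by ring
      _ ≤ R ^ 2 * D := by gcongr; linarith
  have bc : (g 1 0 : ℝ) ^ 2 ≤ C₁ * D := by
    rw [hC₁, div_mul_eq_mul_div, le_div_iff₀ (by positivity)]
    calc (g 1 0 : ℝ) ^ 2 * w.im ^ 2 ≤ (g 1 0 : ℝ) ^ 2 * w.im ^ 2 * (z.im * R) ^ 2 :=
          le_mul_of_one_le_right (by positivity) hyR2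
      _ = R ^ 2 * (w.im * g 1 0 * z.im) ^ 2 := by ring
      _ ≤ R ^ 2 * D := by gcongr; linarith
  have br : r ^ 2 ≤ 1 / w.im ^ 2 * D := by
    rw [div_mul_eq_mul_div, le_div_iff₀ (by positivity)]
    calc r ^ 2 * w.im ^ 2 = (w.im * r) ^ 2 := by ring
      _ ≤ 1 * D := by linarith
  have bd : (g 1 1 : ℝ) ^ 2 ≤ C₂ * D := by
    have t1 : (g 1 1 : ℝ) ^ 2 ≤ 2 * r ^ 2 + 2 * (z.re ^ 2 * (g 1 0 : ℝ) ^ 2) := by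
      have : (g 1 1 : ℝ) = r - g 1 0 * z.re := by rw [hr]; ring
      rw [this]
      linarith [sq_nonneg (r + g 1 0 * z.re : ℝ)]
    have t2 : z.re ^ 2 * (g 1 0 : ℝ) ^ 2 ≤ R ^ 2 * (C₁ * D) := by gcongr
    calc (g 1 1 : ℝ) ^ 2 ≤ 2 * (1 / w.im ^ 2 * D) + 2 * (R ^ 2 * (C₁ * D)) := by linarith
      _ = C₂ * D := by rw [hC₂]; ring
  have ba : (g 0 0 : ℝ) ^ 2 ≤ C₃ * D := by
    have t1 : (g 0 0 : ℝ) ^ 2 ≤ 2 * p ^ 2 + 2 * (w.re ^ 2 * (g 1 0 : ℝ) ^ 2) := by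
      have : (g 0 0 : ℝ) = p + g 1 0 * w.re := by rw [hp]; ring
      rw [this]
      linarith [sq_nonneg (p - g 1 0 * w.re : ℝ)]
    have t2 : w.re ^ 2 * (g 1 0 : ℝ) ^ 2 ≤ w.re ^ 2 * (C₁ * D) := by gcongr
    calc (g 0 0 : ℝ) ^ 2 ≤ 2 * (R ^ 2 * D) + 2 * (w.re ^ 2 * (C₁ * D)) := by linarith
      _ = C₃ * D := by rw [hC₃]; ring
  have bb : (g 0 1 : ℝ) ^ 2 ≤ C₄ * D := by
    have t1 : (g 0 1 : ℝ) ^ 2 ≤ 4 * s ^ 2 + 4 * (z.re ^ 2 * p ^ 2) +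
        2 * (w.re ^ 2 * (g 1 1 : ℝ) ^ 2) := by
      have : (g 0 1 : ℝ) = s - z.re * p + w.re * g 1 1 := by rw [hs, hp]; ring
      rw [this]
      linarith [sq_nonneg (s - z.re * p - w.re * g 1 1), sq_nonneg (s + z.re * p)]
    have t2 : z.re ^ 2 * p ^ 2 ≤ R ^ 2 * (R ^ 2 * D) := by gcongr
    have t3 : w.re ^ 2 * (g 1 1 : ℝ) ^ 2 ≤ w.re ^ 2 * (C₂ * D) := by gcongr
    have t4 : s ^ 2 ≤ D := by linarith
    calc (g 0 1 : ℝ) ^ 2 ≤ 4 * D + 4 * (R ^ 2 * (R ^ 2 * D)) + 2 * (w.re ^ 2 * (C₂ * D)) := by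
          linarith
      _ = C₄ * D := by rw [hC₄]; ring
  have m1 := mul_nonneg h1.le hD0
  have m2 := mul_nonneg h2.le hD0
  have m3 := mul_nonneg h3.le hD0
  have m4 := mul_nonneg h4.le hD0
  have e : (C₀ + C₁ + C₂ + C₃ + C₄) * D = C₀ * D + C₁ * D + C₂ * D + C₃ * D + C₄ * D := by ring
  rw [e]
  intro i j
  fin_cases i <;> fin_cases j <;> simp only [Fin.zero_eta, Fin.mk_one, Fin.isValue] <;> linarith

/-- A summable weight on `SL(2, ℤ)`. -/
noncomputable def entriesWeight (g : SL(2, ℤ)) : ℝ :=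
  (1 / (1 + (g 0 0 : ℝ) ^ 2) * (1 / (1 + (g 0 1 : ℝ) ^ 2))) *
    (1 / (1 + (g 1 0 : ℝ) ^ 2) * (1 / (1 + (g 1 1 : ℝ) ^ 2)))

theorem summable_one_div_one_add_int_sq : Summable fun n : ℤ ↦ 1 / (1 + (n : ℝ) ^ 2) := by
  refine Summable.of_nonneg_of_le (fun n ↦ by positivity) (fun n ↦ ?_)
    ((Real.summable_one_div_int_pow.mpr one_lt_two).add
      (summable_of_ne_finset_zero (f := fun n : ℤ ↦ if n = 0 then (1 : ℝ) else 0) (s := {0})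
        (by intro b hb; simp at hb; simp [hb])))
  by_cases h : n = 0
  · simp [h]
  · have : 0 < (n : ℝ) ^ 2 := by positivity
    simp only [h, if_false, add_zero]
    gcongr
    linarith

theorem summable_entriesWeight : Summable entriesWeight := by
  have h := summable_one_div_one_add_int_sq
  have hn : 0 ≤ fun n : ℤ ↦ 1 / (1 + (n : ℝ) ^ 2) := fun n ↦ by simp only [Pi.zero_apply]; positivity
  have h2 := h.mul_of_nonneg h hn hn
  have hn2 : 0 ≤ fun x : ℤ × ℤ ↦ 1 / (1 + (x.1 : ℝ) ^ 2) * (1 / (1 + (x.2 : ℝ) ^ 2)) :=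
    fun n ↦ by simp only [Pi.zero_apply]; positivity
  have h4 := h2.mul_of_nonneg h2 hn2 hn2
  refine h4.comp_injective (i := fun g : SL(2, ℤ) ↦ ((g 0 0, g 0 1), (g 1 0, g 1 1))) ?_
  intro g g' hg
  simp only [Prod.mk.injEq] at hg
  ext i j
  fin_cases i <;> fin_cases j <;> simp [hg]

/-- Eight of the k factors 1/D pay for summability, two per matrix entry. The other k - 8 use D² ≥ 2
`w.im * z.im` and give decay at the cusp. -/
theorem exists_bound_kernel_term {w : ℂ} (hw : 0 < w.im) {R : ℝ} (hR : 0 < R) {k : ℕ}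
    (hk : 8 ≤ k) : ∃ C : ℝ, 0 < C ∧ ∀ (g : SL(2, ℤ)) (z : ℂ), |z.re| ≤ R → 1 / R ≤ z.im →
      ‖(2 * Complex.I / kernelDenom g w z) ^ k‖ ≤
        C * (1 / Real.sqrt z.im) ^ (k - 8) * entriesWeight g := by
  obtain ⟨C, hC, hCb⟩ := exists_entries_sq_le_norm_kernelDenom_sq hw hR
  refine ⟨2 ^ k * C ^ 4 * (1 / Real.sqrt (2 * w.im)) ^ (k - 8), by positivity,
    fun g z hre him ↦ ?_⟩
  have hy : 0 < z.im := lt_of_lt_of_le (by positivity) him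
  have hD := hCb g z hre him
  have hs : Real.sqrt (2 * w.im) * Real.sqrt z.im ≤ ‖kernelDenom g w z‖ := by
    rw [← Real.sqrt_mul (by positivity)]
    refine Real.sqrt_le_left (norm_nonneg _) |>.mpr ?_ 
    have := two_mul_im_mul_im_le_norm_kernelDenom_sq g w z
    linarith
  have hs0 : 0 < Real.sqrt (2 * w.im) * Real.sqrt z.im := by positivity
  set D := ‖kernelDenom g w z‖ with hDd
  have hD0 : 0 < D := hs0.trans_le hs
  have e : ‖(2 * Complex.I / kernelDenom g w z) ^ k‖ = 2 ^ k * ((1 / D) ^ (k - 8) * (1 / D) ^ 8) := by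
    rw [← pow_add, Nat.sub_add_cancel hk, norm_pow, norm_div, norm_mul, Complex.norm_I,
      Complex.norm_ofNat, mul_one, div_eq_mul_one_div, mul_pow]
  have h8 : (1 / D) ^ 8 ≤ C ^ 4 * entriesWeight g := by
    have hp : (1 + (g 0 0 : ℝ) ^ 2) * (1 + (g 0 1 : ℝ) ^ 2) *
        ((1 + (g 1 0 : ℝ) ^ 2) * (1 + (g 1 1 : ℝ) ^ 2)) ≤ C ^ 4 * D ^ 8 := by
      calc _ ≤ (C * D ^ 2) * (C * D ^ 2) * ((C * D ^ 2) * (C * D ^ 2)) := by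
            gcongr <;> exact hD _ _
        _ = C ^ 4 * D ^ 8 := by ring
    have : entriesWeight g = 1 / ((1 + (g 0 0 : ℝ) ^ 2) * (1 + (g 0 1 : ℝ) ^ 2) *
        ((1 + (g 1 0 : ℝ) ^ 2) * (1 + (g 1 1 : ℝ) ^ 2))) := by
      rw [entriesWeight]; field_simp
    rw [this, div_pow, one_pow, mul_one_div, div_le_div_iff₀ (by positivity) (by positivity)]
    linarith
  have h9 : (1 / D) ^ (k - 8) ≤ (1 / Real.sqrt (2 * w.im)) ^ (k - 8) *
      (1 / Real.sqrt z.im) ^ (k - 8) := by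
    rw [← mul_pow, div_mul_div_comm, one_mul]
    gcongr
  rw [e]
  calc 2 ^ k * ((1 / D) ^ (k - 8) * (1 / D) ^ 8) ≤ 2 ^ k *
      (((1 / Real.sqrt (2 * w.im)) ^ (k - 8) * (1 / Real.sqrt z.im) ^ (k - 8)) *
        (C ^ 4 * entriesWeight g)) := by gcongr
    _ = _ := by ring

theorem kernelDenom_ne_zero (g : SL(2, ℤ)) {w z : ℂ} (hw : 0 < w.im) (hz : 0 < z.im) :
    kernelDenom g w z ≠ 0 := by
  intro h
  have := two_mul_im_mul_im_le_norm_kernelDenom_sq g w z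
  rw [h, norm_zero] at this
  have := mul_pos hw hz
  linarith

theorem exists_box (z : ℂ) (hz : 0 < z.im) : ∃ R : ℝ, 0 < R ∧ |z.re| < R ∧ 1 / R < z.im := by
  refine ⟨|z.re| + 1 / z.im + 1, by positivity, ?_, ?_⟩
  · have : 0 < 1 / z.im := by positivity
    linarith
  · rw [div_lt_iff₀ (by positivity)]
    have : z.im * (|z.re| + 1 / z.im + 1) = z.im * |z.re| + 1 + z.im := by field_simp
    rw [this]
    have : 0 ≤ z.im * |z.re| := by positivity
    linarith

theorem exists_summable_bound_kernel_term {w : ℂ} (hw : 0 < w.im) {R : ℝ} (hR : 0 < R) {k : ℕ}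
    (hk : 8 ≤ k) : ∃ u : SL(2, ℤ) → ℝ, Summable u ∧ ∀ (g : SL(2, ℤ)) (z : ℂ), |z.re| ≤ R →
      1 / R ≤ z.im → ‖(2 * Complex.I / kernelDenom g w z) ^ k‖ ≤ u g := by
  obtain ⟨C, hC, hCb⟩ := exists_bound_kernel_term hw hR hk
  refine ⟨fun g ↦ C * Real.sqrt R ^ (k - 8) * entriesWeight g, summable_entriesWeight.mul_left _,
    fun g z hre him ↦ (hCb g z hre him).trans ?_⟩
  have hy : 0 < z.im := lt_of_lt_of_le (by positivity) him
  have hwt : 0 ≤ entriesWeight g := by unfold entriesWeight; positivity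
  have : 1 / Real.sqrt z.im ≤ Real.sqrt R := by
    rw [← Real.sqrt_one, ← Real.sqrt_div zero_le_one]
    refine Real.sqrt_le_sqrt ?_
    rw [div_le_iff₀ hy]
    rw [div_le_iff₀ hR] at him
    linarith
  have := pow_le_pow_left₀ (by positivity) this (k - 8)
  exact mul_le_mul_of_nonneg_right (mul_le_mul_of_nonneg_left this hC.le) hwt

theorem summable_kernel_term {w z : ℂ} (hw : 0 < w.im) (hz : 0 < z.im) {k : ℕ} (hk : 8 ≤ k) :
    Summable fun g : SL(2, ℤ) ↦ ‖(2 * Complex.I / kernelDenom g w z) ^ k‖ := by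
  obtain ⟨R, hR, h1, h2⟩ := exists_box z hz
  obtain ⟨u, hu, hub⟩ := exists_summable_bound_kernel_term hw hR hk
  exact Summable.of_nonneg_of_le (fun g ↦ norm_nonneg _) (fun g ↦ hub g z h1.le h2.le) hu

/-- The sum of the translates of the Bergman kernel over `SL(2, ℤ)`. -/
noncomputable def kernelSeries (k : ℕ) (w : ℍ) (z : ℍ) : ℂ :=
  ∑' g : SL(2, ℤ), (2 * Complex.I / kernelDenom g w z) ^ k

/-- The terms are the slashes of one function, so slashing by h only reindexes the sum. -/
theorem kernelSeries_slash (k : ℕ) (w : ℍ) (h : SL(2, ℤ)) :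
    kernelSeries k w ∣[(k : ℤ)] h = kernelSeries k w := by
  ext z
  have e : ∀ z, kernelSeries k w z = ∑' g : SL(2, ℤ), (bergmanKernel k w ∣[(k : ℤ)] g) z := by
    intro z
    simp only [kernelSeries, bergmanKernel_slash]
  rw [ModularForm.SL_slash_apply, e, e, ← tsum_mul_right,
    ← (Equiv.mulRight h).tsum_eq (fun g ↦ (bergmanKernel k w ∣[(k : ℤ)] g) z)]
  refine tsum_congr fun g ↦ ?_
  rw [Equiv.coe_mulRight, SlashAction.slash_mul, ModularForm.SL_slash_apply (γ := h)]

theorem kernelSeries_mdifferentiable {k : ℕ} (hk : 8 ≤ k) (w : ℍ) : MDiff (kernelSeries k w) := by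
  rw [UpperHalfPlane.mdifferentiable_iff]
  intro z hz
  obtain ⟨R, hR, h1, h2⟩ := exists_box z hz
  obtain ⟨u, hu, hub⟩ := exists_summable_bound_kernel_term w.im_pos hR hk
  set U : Set ℂ := {z : ℂ | |z.re| < R} ∩ {z : ℂ | 1 / R < z.im}
  have hU : IsOpen U := (isOpen_lt (by fun_prop) (by fun_prop)).inter
    (isOpen_lt (by fun_prop) (by fun_prop))
  have hpos : ∀ z ∈ U, 0 < z.im := fun z hz ↦ lt_trans (by positivity) hz.2
  have hd : DifferentiableOn ℂ (fun z ↦ ∑' g : SL(2, ℤ),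
      (2 * Complex.I / kernelDenom g w z) ^ k) U := by
    refine Complex.differentiableOn_tsum_of_summable_norm hu (fun g ↦ ?_) hU
      fun g z hz ↦ hub g z (le_of_lt hz.1) (le_of_lt hz.2)
    refine DifferentiableOn.pow (DifferentiableOn.div (by fun_prop)
      (by unfold kernelDenom; fun_prop) fun z hz ↦ kernelDenom_ne_zero g w.im_pos (hpos z hz)) _
  have hc : DifferentiableOn ℂ (kernelSeries k w ∘ UpperHalfPlane.ofComplex) U := by
    refine hd.congr fun z hz ↦ ?_
    simp only [Function.comp_apply, kernelSeries,
      UpperHalfPlane.ofComplex_apply_of_im_pos (hpos z hz)]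
  exact (hc.differentiableAt (hU.mem_nhds ⟨h1, h2⟩)).differentiableWithinAt

theorem kernelSeries_T_zpow_smul (k : ℕ) (w z : ℍ) (n : ℤ) :
    kernelSeries k w (ModularGroup.T ^ n • z) = kernelSeries k w z := by
  conv_rhs => rw [← kernelSeries_slash k w (ModularGroup.T ^ n)]
  rw [ModularForm.SL_slash_apply, denom_coe_eq]
  have h0 : (ModularGroup.T ^ n) 1 0 = 0 := by
    have := congrFun (congrFun (ModularGroup.coe_T_zpow n) 1) 0
    simpa using this
  have h1 : (ModularGroup.T ^ n) 1 1 = 1 := by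
    have := congrFun (congrFun (ModularGroup.coe_T_zpow n) 1) 1
    simpa using this
  rw [h0, h1]
  simp

/-- An integer translation brings z into |Re z| ≤ 1, where the bound is uniform; k ≥ 9 leaves at
least one factor 1/√(Im z). -/
theorem kernelSeries_isZeroAtImInfty {k : ℕ} (hk : 9 ≤ k) (w : ℍ) :
    UpperHalfPlane.IsZeroAtImInfty (kernelSeries k w) := by
  obtain ⟨C, hC, hCb⟩ := exists_bound_kernel_term w.im_pos one_pos (show 8 ≤ k by omega)
  set S := ∑' g, entriesWeight g with hS
  have hb : ∀ z : ℍ, 1 ≤ z.im → ‖kernelSeries k w z‖ ≤ C * (1 / Real.sqrt z.im) ^ (k - 8) * S := by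
    intro z hz
    have h1 : |((ModularGroup.T ^ (-⌊z.re⌋) • z : ℍ) : ℂ).re| ≤ 1 := by
      rw [UpperHalfPlane.coe_re, ModularGroup.re_T_zpow_smul, abs_le]
      push_cast
      constructor <;> linarith [Int.floor_le z.re, Int.lt_floor_add_one z.re]
    have h2 : ((ModularGroup.T ^ (-⌊z.re⌋) • z : ℍ) : ℂ).im = z.im := by
      rw [UpperHalfPlane.coe_im, ModularGroup.im_T_zpow_smul]
    rw [← kernelSeries_T_zpow_smul k w z (-⌊z.re⌋), kernelSeries, hS, ← tsum_mul_left]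
    have hb' := fun g ↦ hCb g (ModularGroup.T ^ (-⌊z.re⌋) • z : ℍ) h1 (by rw [h2]; simpa using hz)
    rw [h2] at hb'
    exact tsum_of_norm_bounded (summable_entriesWeight.mul_left _).hasSum hb'
  have hlim : Filter.Tendsto (fun z : ℍ ↦ C * (1 / Real.sqrt z.im) ^ (k - 8) * S)
      UpperHalfPlane.atImInfty (nhds 0) := by
    have h1 : Filter.Tendsto (fun y : ℝ ↦ C * (1 / Real.sqrt y) ^ (k - 8) * S)
        Filter.atTop (nhds (C * 0 ^ (k - 8) * S)) := by
      refine (Filter.Tendsto.const_mul _ (Filter.Tendsto.pow ?_ _)).mul_const _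
      simp only [one_div]
      exact tendsto_inv_atTop_zero.comp Real.tendsto_sqrt_atTop
    rw [zero_pow (by omega), mul_zero, zero_mul] at h1
    exact h1.comp Filter.tendsto_comap
  refine squeeze_zero_norm' ?_ hlim
  rw [UpperHalfPlane.atImInfty, Filter.eventually_comap]
  filter_upwards [Filter.eventually_ge_atTop 1] with y hy z hz
  exact hb z (hz ▸ hy)

/-- The sum of the translates of the Bergman kernel, as a cusp form. -/
noncomputable def kernelCuspForm {k : ℕ} (hk : 9 ≤ k) (w : ℍ) : CuspForm 𝒮ℒ (k : ℤ) where
  toFun := kernelSeries k w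
  slash_action_eq' := fun _ ⟨γ, hγ⟩ ↦ hγ ▸ kernelSeries_slash k w γ
  holo' := kernelSeries_mdifferentiable (by omega) w
  zero_at_cusps' hc := by
    rw [Subgroup.IsArithmetic.isCusp_iff_isCusp_SL2Z] at hc
    rw [OnePoint.isZeroAt_iff_forall_SL2Z hc]
    intro γ _
    rw [kernelSeries_slash]
    exact kernelSeries_isZeroAtImInfty hk w

theorem kernelCuspForm_apply {k : ℕ} (hk : 9 ≤ k) (w z : ℍ) :
    kernelCuspForm hk w z = kernelSeries k w z := rfl

/-! ### Reproducing property on cusp forms and the pretrace formula -/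

section Pretrace

variable {k : ℕ}

theorem bergman_weighted_eq {k : ℕ} (hk : 2 ≤ k) (f : ℍ → ℂ) (w : ℍ) {z : ℂ} (hz : 0 < z.im) :
    ((1 / z.im) ^ 2 : ℝ) • (conj ((2 * Complex.I / (z - conj (w : ℂ))) ^ k) *
      f (UpperHalfPlane.ofComplex z) * (z.im : ℂ) ^ k) =
    conj ((2 * Complex.I / (z - conj (w : ℂ))) ^ (k - 2 + 2)) *
      (f ∘ UpperHalfPlane.ofComplex) z * (z.im : ℂ) ^ (k - 2) := by
  have h0 : (z.im : ℂ) ≠ 0 := by exact_mod_cast hz.ne'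
  obtain ⟨n, rfl⟩ := Nat.exists_eq_add_of_le' hk
  simp only [Nat.add_sub_cancel, Complex.real_smul, Function.comp_apply]
  push_cast
  rw [pow_add (z.im : ℂ)]
  field_simp

theorem petersson_bergmanKernel_eq (f : ℍ → ℂ) (w τ : ℍ) :
    UpperHalfPlane.petersson k (bergmanKernel k w) f τ =
      conj ((2 * Complex.I / ((τ : ℂ) - conj (w : ℂ))) ^ k) *
        f (UpperHalfPlane.ofComplex (τ : ℂ)) * ((τ : ℂ).im : ℂ) ^ k := by
  simp [UpperHalfPlane.petersson, bergmanKernel]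

theorem exists_bound_cuspForm_comp_ofComplex (f : CuspForm 𝒮ℒ (k : ℤ)) :
    ∃ M : ℝ, ∀ z : ℂ, 0 < z.im → ‖(f ∘ UpperHalfPlane.ofComplex) z‖ ^ 2 * z.im ^ k ≤ M := by
  obtain ⟨M, hM⟩ := CuspFormClass.petersson_bounded_left (k : ℤ) 𝒮ℒ f f
  refine ⟨M, fun z hz ↦ ?_⟩
  refine le_trans (le_of_eq ?_) (hM (UpperHalfPlane.ofComplex z))
  rw [UpperHalfPlane.ofComplex_apply_of_im_pos hz]
  simp [UpperHalfPlane.petersson, UpperHalfPlane.ofComplex_apply_of_im_pos hz,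
    abs_of_pos hz, sq]

theorem integrable_petersson_bergmanKernel (hk : 4 ≤ k) (f : CuspForm 𝒮ℒ (k : ℤ)) (w : ℍ) :
    Integrable (UpperHalfPlane.petersson k (bergmanKernel k w) f) := by
  obtain ⟨M, hM⟩ := exists_bound_cuspForm_comp_ofComplex f
  have h := integrableOn_halfPlane_bergman w.im_pos (n := k - 2) (by omega)
    (UpperHalfPlane.mdifferentiable_iff.mp f.holo') (M := M)
    (by rwa [Nat.sub_add_cancel (by omega)])
  have h2 : Integrable fun τ : ℍ ↦ conj ((2 * Complex.I / ((τ : ℂ) - conj (w : ℂ))) ^ k) *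
      f (UpperHalfPlane.ofComplex (τ : ℂ)) * ((τ : ℂ).im : ℂ) ^ k :=
    (UpperHalfPlane.integrable_iff_integrableOn_complex fun z ↦
      conj ((2 * Complex.I / (z - conj (w : ℂ))) ^ k) *
        f (UpperHalfPlane.ofComplex z) * (z.im : ℂ) ^ k).mpr
      (IntegrableOn.congr_fun h (fun z hz ↦ (bergman_weighted_eq (by omega) f w hz).symm)
        UpperHalfPlane.isOpen_upperHalfPlaneSet.measurableSet)
  exact h2.congr (Filter.Eventually.of_forall fun τ ↦ (petersson_bergmanKernel_eq f w τ).symm)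

theorem integral_petersson_bergmanKernel (hk : 4 ≤ k) (f : CuspForm 𝒮ℒ (k : ℤ)) (w : ℍ) :
    ∫ τ, UpperHalfPlane.petersson k (bergmanKernel k w) f τ = 4 * Real.pi / (k - 1) * f w := by
  obtain ⟨M, hM⟩ := exists_bound_cuspForm_comp_ofComplex f
  have h := integral_halfPlane_bergman w.im_pos (n := k - 2) (by omega)
    (UpperHalfPlane.mdifferentiable_iff.mp f.holo') (M := M)
    (by rwa [Nat.sub_add_cancel (by omega)])
  simp only [petersson_bergmanKernel_eq]
  rw [UpperHalfPlane.integral_eq_integral_complex (fun z : ℂ ↦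
      conj ((2 * Complex.I / (z - conj (w : ℂ))) ^ k) *
        f (UpperHalfPlane.ofComplex z) * (z.im : ℂ) ^ k),
    setIntegral_congr_fun UpperHalfPlane.isOpen_upperHalfPlaneSet.measurableSet
      (fun z hz ↦ bergman_weighted_eq (by omega) f w hz)]
  refine h.trans ?_
  rw [Nat.cast_sub (by omega)]
  simp only [Function.comp_apply, UpperHalfPlane.ofComplex_apply]
  congr 2
  push_cast
  ring

theorem continuous_bergmanKernel (k : ℕ) (w : ℍ) : Continuous (bergmanKernel k w) := by
  unfold bergmanKernel
  refine Continuous.pow (Continuous.div continuous_const (by fun_prop) fun z h ↦ ?_) _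
  have := congrArg Complex.im h
  simp at this
  linarith [z.im_pos, w.im_pos]

/-- Since f is slash invariant, the group action falls on the kernel alone. -/
theorem petersson_kernelSeries_eq_tsum (f : CuspForm 𝒮ℒ (k : ℤ)) (w z : ℍ) :
    UpperHalfPlane.petersson k (kernelSeries k w) f z =
      ∑' g : SL(2, ℤ), UpperHalfPlane.petersson k (bergmanKernel k w) f (g • z) := by
  have hf : ∀ g : SL(2, ℤ), (f : ℍ → ℂ) ∣[(k : ℤ)] g = f := fun g ↦
    f.slash_action_eq' _ ⟨g, rfl⟩
  have h : ∀ g : SL(2, ℤ), UpperHalfPlane.petersson k (bergmanKernel k w) f (g • z) =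
      conj ((2 * Complex.I / kernelDenom g w z) ^ k) * (f z * (z.im : ℂ) ^ (k : ℤ)) := by
    intro g
    rw [← UpperHalfPlane.petersson_slash_SL, hf, UpperHalfPlane.petersson, bergmanKernel_slash,
      mul_assoc]
  simp only [h]
  rw [tsum_mul_right, ← Complex.conj_tsum, UpperHalfPlane.petersson, kernelSeries, mul_assoc]

theorem peterssonInner_kernelCuspForm (hk : 9 ≤ k) (f : CuspForm 𝒮ℒ (k : ℤ)) (w : ℍ) :
    peterssonInner k (kernelCuspForm hk w) f = 8 * Real.pi / (k - 1) * f w := by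
  have hc : Continuous (UpperHalfPlane.petersson k (bergmanKernel k w) f) :=
    UpperHalfPlane.petersson_continuous _ (continuous_bergmanKernel k w) f.holo'.continuous
  have h := ModularGroup.integral_fd_tsum_smul
    (integrable_petersson_bergmanKernel (by omega) f w) hc
  rw [integral_petersson_bergmanKernel (by omega)] at h
  rw [peterssonInner]
  change ∫ z in 𝒟, UpperHalfPlane.petersson k (kernelSeries k w) f z = _
  simp only [petersson_kernelSeries_eq_tsum, h, Complex.real_smul]
  push_cast
  ring

variable {ι : Type*} {B : Module.Basis ι ℂ (CuspForm 𝒮ℒ (k : ℤ))}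

/-- A non-integrable function has integral 0 by convention, so norm 1 forces the diagonal case; the
mixed case follows from |ab| ≤ |a|² + |b|². -/
theorem IsPeterssonOrthonormal.integrableOn (hB : IsPeterssonOrthonormal B) (i j : ι) :
    IntegrableOn (UpperHalfPlane.petersson k (B i) (B j)) 𝒟 := by
  have hd : ∀ i, IntegrableOn (UpperHalfPlane.petersson k (B i) (B i)) 𝒟 := by
    intro i
    by_contra h
    have h1 := hB.1 i
    rw [peterssonInner, integral_undef h] at h1
    exact zero_ne_one h1
  refine Integrable.mono ((hd i).norm.add (hd j).norm)
    (UpperHalfPlane.petersson_continuous _ (B i).holo'.continuous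
      (B j).holo'.continuous).aestronglyMeasurable (Filter.Eventually.of_forall fun z ↦ ?_)
  simp only [UpperHalfPlane.petersson, norm_mul, RCLike.norm_conj, Pi.add_apply]
  rw [Real.norm_of_nonneg (by positivity), ← add_mul]
  gcongr
  nlinarith [sq_nonneg (‖B i z‖ - ‖B j z‖), sq_nonneg (‖B i z‖ + ‖B j z‖)]

theorem peterssonInner_sum_smul [Fintype ι] (hB : IsPeterssonOrthonormal B) (c : ι → ℂ) (j : ι) :
    peterssonInner k (∑ i, c i • B i) (B j) = conj (c j) := by
  have e : ∀ z, UpperHalfPlane.petersson k (∑ i, c i • B i : CuspForm 𝒮ℒ (k : ℤ)) (B j) z =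
      ∑ i, conj (c i) * UpperHalfPlane.petersson k (B i) (B j) z := by
    intro z
    have : (∑ i, c i • B i : CuspForm 𝒮ℒ (k : ℤ)) z = ∑ i, c i * B i z := by
      simp
    simp only [UpperHalfPlane.petersson, this, map_sum, map_mul, Finset.sum_mul, mul_assoc]
  rw [peterssonInner]
  simp only [e]
  rw [integral_finsetSum _ fun i _ ↦ (hB.integrableOn i j).const_mul _]
  simp only [integral_const_mul]
  rw [Finset.sum_eq_single j]
  · have := hB.1 j
    rw [peterssonInner] at this
    rw [this, mul_one]
  · intro i _ hij
    have := hB.2 i j hij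
    rw [peterssonInner] at this
    rw [this, mul_zero]
  · simp

/-- Pairing the kernel with each basis element gives its coefficients by the reproducing property;
the expansion is then evaluated at w. -/
theorem kernelSeries_diag_eq [Fintype ι] (hk : 9 ≤ k) (hB : IsPeterssonOrthonormal B) (w : ℍ) :
    kernelSeries k w w = ((8 * Real.pi / (k - 1) * ∑ i, ‖B i w‖ ^ 2 : ℝ) : ℂ) := by
  set H := kernelCuspForm hk w with hH
  have hc : ∀ j, B.repr H j = 8 * Real.pi / (k - 1) * conj (B j w) := by
    intro j
    have h := peterssonInner_sum_smul hB (fun i ↦ B.repr H i) j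
    rw [B.sum_repr, hH, peterssonInner_kernelCuspForm] at h
    rw [← Complex.conj_conj (B.repr H j), ← h]
    simp [map_ofNat (starRingEnd ℂ) 8]
  have h1 : H w = ∑ i, B.repr H i * B i w := by
    have hs : ∀ c : ι → ℂ, (∑ i, c i • B i : CuspForm 𝒮ℒ (k : ℤ)) w = ∑ i, c i * B i w := by simp
    rw [← hs, B.sum_repr]
  rw [← kernelCuspForm_apply hk, ← hH, h1]
  simp only [hc]
  push_cast
  rw [Finset.mul_sum]
  refine Finset.sum_congr rfl fun i _ ↦ ?_
  rw [mul_assoc, mul_comm (conj (B i w)), Complex.mul_conj, Complex.normSq_eq_norm_sq]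
  push_cast
  rfl

end Pretrace

end

/-! ### One-variable integrals -/

section

open MeasureTheory Set Metric

theorem setLIntegral_Ioo_le_of_hasDerivAt {a b : ℝ} (hab : a ≤ b) {f G G' : ℝ → ℝ}
    (hG : ∀ y ∈ Icc a b, HasDerivAt G (G' y) y) (hc : ContinuousOn G' (Icc a b))
    (h0 : ∀ y ∈ Icc a b, 0 ≤ G' y) (hf : ∀ y ∈ Ioo a b, f y ≤ G' y) :
    ∫⁻ y in Ioo a b, ENNReal.ofReal (f y) ≤ ENNReal.ofReal (G b - G a) := by
  have hi : IntervalIntegrable G' volume a b :=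
    ContinuousOn.intervalIntegrable (by rwa [uIcc_of_le hab])
  have hI : IntegrableOn G' (Ioo a b) :=
    ((intervalIntegrable_iff_integrableOn_Ioc_of_le hab).mp hi).mono_set Ioo_subset_Ioc_self
  rw [← intervalIntegral.integral_eq_sub_of_hasDerivAt (by rwa [uIcc_of_le hab]) hi,
    intervalIntegral.integral_of_le hab, integral_Ioc_eq_integral_Ioo,
    ofReal_integral_eq_lintegral_ofReal hI]
  · exact setLIntegral_mono' measurableSet_Ioo fun y hy ↦ ENNReal.ofReal_le_ofReal (hf y hy)
  · exact (ae_restrict_iff' measurableSet_Ioo).mpr (Filter.Eventually.of_forall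
      fun y hy ↦ h0 y (Ioo_subset_Icc_self hy))

theorem setLIntegral_inv_cube_le {a b : ℝ} (ha : 0 < a) :
    ∫⁻ y in Ioo a b, ENNReal.ofReal (1 / y ^ 2 * (1 / y)) ≤ ENNReal.ofReal (1 / a ^ 2) := by
  rcases le_or_gt b a with hba | hab
  · simp [Ioo_eq_empty (not_lt.mpr hba)]
  have hpos : ∀ y ∈ Icc a b, 0 < y := fun y hy ↦ ha.trans_le hy.1
  refine (setLIntegral_Ioo_le_of_hasDerivAt hab.le (G := fun y ↦ -(1 / 2) * (y ^ 2)⁻¹)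
    (G' := fun y ↦ 1 / y ^ 2 * (1 / y)) (fun y hy ↦ ?_) ?_ (fun y hy ↦ ?_)
    fun y _ ↦ le_rfl).trans (ENNReal.ofReal_le_ofReal ?_)
  · have hy0 := (hpos y hy).ne'
    refine (((hasDerivAt_pow 2 y).inv (pow_ne_zero 2 hy0)).const_mul (-(1 / 2))).congr_deriv ?_
    field_simp
    norm_num
  · exact (continuousOn_const.div (by fun_prop) fun y hy ↦ pow_ne_zero 2 (hpos y hy).ne').mul
      (continuousOn_const.div (by fun_prop) fun y hy ↦ (hpos y hy).ne')
  · have := hpos y hy; positivity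
  · have h1 : 0 ≤ (b ^ 2)⁻¹ := by positivity
    have h2 : 0 ≤ (a ^ 2)⁻¹ := by positivity
    rw [one_div (a ^ 2)]
    norm_num
    linarith

theorem setLIntegral_id_le {a b : ℝ} (ha : 0 < a) :
    ∫⁻ y in Ioo a b, ENNReal.ofReal y ≤ ENNReal.ofReal (b ^ 2) := by
  rcases le_or_gt b a with hba | hab
  · simp [Ioo_eq_empty (not_lt.mpr hba)]
  refine (setLIntegral_Ioo_le_of_hasDerivAt hab.le (G := fun y ↦ 1 / 2 * y ^ 2)
    (G' := fun y ↦ y) (fun y hy ↦ ?_) (by fun_prop) (fun y hy ↦ ha.le.trans hy.1)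
    fun y _ ↦ le_rfl).trans (ENNReal.ofReal_le_ofReal ?_)
  · refine ((hasDerivAt_pow 2 y).const_mul (1 / 2)).congr_deriv ?_
    norm_num
    ring
  · nlinarith [sq_nonneg a, sq_nonneg b]

/-- Substitute v = cy + s/y. Since (cy - s/y)² = v² - 4cs ≥ 3, dv dominates dy/y, and the integral
of 1/(1 + Kv²/4) over the line is 2π/√K < 7/√K. -/
theorem setLIntegral_lorentzian_le {a b c s K : ℝ} (ha : 0 < a) (hc : 0 < c) (hcs : c * s ≤ -(3 / 4))
    (hK : 0 < K) :
    ∫⁻ y in Ioo a b, ENNReal.ofReal (1 / (1 + K * ((c * y + s / y) ^ 2 / 4)) * (1 / y)) ≤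
      ENNReal.ofReal (7 / Real.sqrt K) := by
  rcases le_or_gt b a with hba | hab
  · simp [Ioo_eq_empty (not_lt.mpr hba)]
  have hpos : ∀ y ∈ Icc a b, 0 < y := fun y hy ↦ ha.trans_le hy.1
  have hsK : 0 < Real.sqrt K := Real.sqrt_pos.mpr hK
  have hs0 : s < 0 := by
    by_contra h
    have := mul_nonneg hc.le (not_lt.mp h)
    linarith
  have hv : ∀ y ∈ Icc a b, 1 / y ≤ c - s / y ^ 2 := by
    intro y hy
    have hy0 := hpos y hy
    have h1 : 1 ≤ c * y - s / y := by
      have h2 : 0 ≤ c * y - s / y := by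
        have := div_neg_of_neg_of_pos hs0 hy0
        have := mul_pos hc hy0
        linarith
      refine (one_le_sq_iff₀ h2).mp ?_
      have : (c * y - s / y) ^ 2 = (c * y + s / y) ^ 2 - 4 * (c * s) := by field_simp; ring
      rw [this]
      nlinarith [sq_nonneg (c * y + s / y)]
    calc 1 / y ≤ (c * y - s / y) / y := by gcongr
      _ = c - s / y ^ 2 := by field_simp
  refine (setLIntegral_Ioo_le_of_hasDerivAt hab.le
    (G := fun y ↦ 2 / Real.sqrt K * Real.arctan (Real.sqrt K / 2 * (c * y + s / y)))
    (G' := fun y ↦ 1 / (1 + K * ((c * y + s / y) ^ 2 / 4)) * (c - s / y ^ 2))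
    (fun y hy ↦ ?_) ?_ (fun y hy ↦ ?_) fun y hy ↦ ?_).trans (ENNReal.ofReal_le_ofReal ?_)
  · have hy0 := (hpos y hy).ne'
    have hd : HasDerivAt (fun y ↦ Real.sqrt K / 2 * (c * y + s / y))
        (Real.sqrt K / 2 * (c - s / y ^ 2)) y := by
      have h1 := ((hasDerivAt_id' y).const_mul c).add ((hasDerivAt_inv hy0).const_mul s)
      have h2 := h1.const_mul (Real.sqrt K / 2)
      simp only [← div_eq_mul_inv] at h2
      refine h2.congr_deriv ?_
      field_simp
      ring
    refine (hd.arctan.const_mul (2 / Real.sqrt K)).congr_deriv ?_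
    have e : (Real.sqrt K / 2 * (c * y + s / y)) ^ 2 = K * ((c * y + s / y) ^ 2 / 4) := by
      rw [mul_pow, div_pow, Real.sq_sqrt hK.le]; ring
    rw [e]
    generalize 1 + K * ((c * y + s / y) ^ 2 / 4) = u
    field_simp
  · have h1 : ContinuousOn (fun y ↦ c * y + s / y) (Icc a b) :=
      (by fun_prop : ContinuousOn (fun y ↦ c * y) (Icc a b)).add
        (continuousOn_const.div (by fun_prop) fun y hy ↦ (hpos y hy).ne')
    refine ContinuousOn.mul (continuousOn_const.div (by fun_prop) fun y hy ↦ by positivity) ?_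
    exact continuousOn_const.sub (continuousOn_const.div (by fun_prop)
      fun y hy ↦ pow_ne_zero 2 (hpos y hy).ne')
  · have h1 := hv y hy
    have h2 : 0 < 1 / y := one_div_pos.mpr (hpos y hy)
    have : 0 ≤ c - s / y ^ 2 := by linarith
    positivity
  · exact mul_le_mul_of_nonneg_left (hv y (Ioo_subset_Icc_self hy)) (by positivity)
  · have h1 := Real.arctan_lt_pi_div_two (Real.sqrt K / 2 * (c * b + s / b))
    have h2 := Real.neg_pi_div_two_lt_arctan (Real.sqrt K / 2 * (c * a + s / a))
    have h3 := Real.pi_lt_d2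
    rw [← mul_sub, div_mul_eq_mul_div]
    gcongr
    linarith

/-- The value of `cosh²` at half the hyperbolic distance from `x + iy` to its image under the matrix
`(a, b; c, d)`, in the coordinates `α = a - cx`, `δ = cx + d`, `s = αx + b - dx`. -/
noncomputable def coshSq (α δ c s y : ℝ) : ℝ := (s ^ 2 / y ^ 2 + c ^ 2 * y ^ 2 + α ^ 2 + δ ^ 2 + 2) / 4

/-! ### Decay for a single matrix along a vertical line -/

section CoshSq

variable {α δ c s y : ℝ}

theorem one_add_mul_le_coshSq_pow {P : ℝ} (hP : 1 ≤ P) (K : ℕ) : 1 + K * (P - 1) ≤ P ^ K := by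
  have := one_add_mul_le_pow (show -2 ≤ P - 1 by linarith) K
  simpa using this

/-- Using αδ - cs = 1 with one sign or the other completes the squares in two ways. This form suits
|trace| ≤ 1; `coshSq_eq_trace` suits |trace| ≥ 2. -/
theorem coshSq_eq_one_add (h : α * δ - c * s = 1) (hy : 0 < y) :
    coshSq α δ c s y = 1 + ((α - δ) ^ 2 + (c * y + s / y) ^ 2) / 4 := by
  rw [coshSq]
  field_simp
  linear_combination 2 * y ^ 2 * h

theorem coshSq_eq_trace (h : α * δ - c * s = 1) (hy : 0 < y) :
    coshSq α δ c s y = ((α + δ) ^ 2 + (c * y - s / y) ^ 2) / 4 := by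
  rw [coshSq]
  field_simp
  linear_combination (-2) * y ^ 2 * h

theorem one_le_coshSq (h : α * δ - c * s = 1) (hy : 0 < y) : 1 ≤ coshSq α δ c s y := by
  rw [coshSq_eq_one_add h hy]
  have : 0 ≤ ((α - δ) ^ 2 + (c * y + s / y) ^ 2) / 4 := by positivity
  linarith

theorem prod_le_coshSq_cube (α δ c s y : ℝ) :
    (1 + α ^ 2) * (1 + δ ^ 2) * (1 + c ^ 2 * y ^ 2) ≤ 64 * coshSq α δ c s y ^ 3 := by
  have h1 : 0 ≤ s ^ 2 / y ^ 2 := by positivity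
  have h2 : 0 ≤ c ^ 2 * y ^ 2 := by positivity
  have e : ∀ u : ℝ, u ≤ c ^ 2 * y ^ 2 + α ^ 2 + δ ^ 2 → 1 + u ≤ 4 * coshSq α δ c s y := by
    intro u hu
    rw [coshSq]
    linarith
  calc _ ≤ (4 * coshSq α δ c s y) * (4 * coshSq α δ c s y) * (4 * coshSq α δ c s y) := by
        have hα := e (α ^ 2) (by linarith [sq_nonneg δ])
        have hδ := e (δ ^ 2) (by linarith [sq_nonneg α])
        have hP : 0 ≤ coshSq α δ c s y := by linarith [sq_nonneg α]
        have hκ := e (c ^ 2 * y ^ 2) (by linarith [sq_nonneg α, sq_nonneg δ])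
        gcongr
    _ = _ := by ring

/-- Three factors of P pay for decay in α, δ and cy; Bernoulli's inequality treats the other K. -/
theorem inv_coshSq_pow_le (h : α * δ - c * s = 1) (hc : c ≠ 0) (hy : 0 < y) (K : ℕ) :
    (1 / coshSq α δ c s y) ^ (K + 3) ≤ 64 / ((1 + α ^ 2) * (1 + δ ^ 2)) *
      (1 / (1 + c ^ 2 * y ^ 2) * (1 / (1 + K * (coshSq α δ c s y - 1)))) := by
  have h1 := one_le_coshSq h hy
  have h2 := one_add_mul_le_coshSq_pow h1 K
  have h3 := prod_le_coshSq_cube α δ c s y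
  set P := coshSq α δ c s y
  have hP : 0 < P := by linarith
  have h4 : 0 < 1 + K * (P - 1) := by
    have : 0 ≤ K * (P - 1) := mul_nonneg (Nat.cast_nonneg K) (by linarith)
    linarith
  rw [← mul_assoc, div_mul_div_comm, mul_one, div_mul_div_comm, mul_one, div_pow, one_pow,
    div_le_div_iff₀ (by positivity) (by positivity), pow_add]
  calc 1 * ((1 + α ^ 2) * (1 + δ ^ 2) * (1 + c ^ 2 * y ^ 2) * (1 + K * (P - 1)))
      ≤ 1 * (64 * P ^ 3 * P ^ K) := by gcongr
    _ = 64 * (P ^ K * P ^ 3) := by ring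

/-- If |trace| = 2 then αδ ≤ 1, so cs ≤ 0 and P - 1 ≥ κ²/4 with κ = |cy|; then 1 + Kκ²/4 ≥ √K κ by
AM-GM, and 1 + κ² ≥ κ. If |trace| ≥ 3 then P - 1 ≥ 1. An integer trace leaves no gap between the
two. -/
theorem inv_coshSq_pow_le_of_two_le_trace (h : α * δ - c * s = 1) (hc : c ≠ 0) (hy : 0 < y)
    {K : ℕ} (hK : 1 ≤ K) (ht : |α + δ| = 2 ∨ 3 ≤ |α + δ|) :
    (1 / coshSq α δ c s y) ^ (K + 3) ≤ 64 / ((1 + α ^ 2) * (1 + δ ^ 2) * c ^ 2) *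
      (1 / Real.sqrt K * (1 / y ^ 2)) := by
  refine (inv_coshSq_pow_le h hc hy K).trans ?_
  rw [div_mul_eq_div_div (64 : ℝ) _ (c ^ 2), div_mul_eq_mul_div (64 / _) (c ^ 2) _, mul_div_assoc]
  refine mul_le_mul_of_nonneg_left ?_ (by positivity)
  have hK0 : (1 : ℝ) ≤ K := by exact_mod_cast hK
  have hsK : 0 < Real.sqrt K := Real.sqrt_pos.mpr (by linarith)
  have hsK2 : Real.sqrt K ^ 2 = K := Real.sq_sqrt (by linarith)
  have h1 := one_le_coshSq h hy
  have h4 : 0 < 1 + K * (coshSq α δ c s y - 1) := by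
    have : 0 ≤ K * (coshSq α δ c s y - 1) := mul_nonneg (Nat.cast_nonneg K) (by linarith)
    linarith
  have e : 1 / Real.sqrt K * (1 / y ^ 2) / c ^ 2 = 1 / (Real.sqrt K * (c ^ 2 * y ^ 2)) := by
    field_simp
  have hκ : 0 < c ^ 2 * y ^ 2 := by positivity
  rw [e, div_mul_div_comm, one_mul]
  refine one_div_le_one_div_of_le (by positivity) ?_
  rcases ht with ht | ht
  · have ht2 : (α + δ) ^ 2 = 4 := by rw [← sq_abs, ht]; norm_num
    have h5 : (c * y) ^ 2 / 4 ≤ coshSq α δ c s y - 1 := by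
      rw [coshSq_eq_trace h hy, ht2]
      have h6 : c * s ≤ 0 := by nlinarith [sq_nonneg (α - δ)]
      have h7 : (c * y - s / y) ^ 2 = (c * y) ^ 2 - 2 * (c * s) + (s / y) ^ 2 := by
        field_simp
        ring
      rw [h7]
      nlinarith [sq_nonneg (s / y)]
    set κ := |c * y| with hκd
    have hκ2 : c ^ 2 * y ^ 2 = κ ^ 2 := by rw [hκd, sq_abs]; ring
    have hκ0 : 0 ≤ κ := abs_nonneg _
    have h8 : Real.sqrt K * κ ≤ 1 + K * (coshSq α δ c s y - 1) := by
      have : (K : ℝ) * (κ ^ 2 / 4) ≤ K * (coshSq α δ c s y - 1) := by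
        rw [← hκ2, ← mul_pow]; gcongr
      have h9 : 0 ≤ (1 - Real.sqrt K * κ / 2) ^ 2 := sq_nonneg _
      have h10 : (1 - Real.sqrt K * κ / 2) ^ 2 = 1 - Real.sqrt K * κ + K * (κ ^ 2 / 4) := by
        linear_combination (κ ^ 2 / 4) * hsK2
      linarith
    calc Real.sqrt K * (c ^ 2 * y ^ 2) = κ * (Real.sqrt K * κ) := by rw [hκ2]; ring
      _ ≤ (1 + c ^ 2 * y ^ 2) * (1 + K * (coshSq α δ c s y - 1)) := by
        gcongr
        rw [hκ2]
        nlinarith [sq_nonneg (κ - 1)]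
  · have ht2 : 9 ≤ (α + δ) ^ 2 := by rw [← sq_abs]; nlinarith
    have h5 : 1 ≤ coshSq α δ c s y - 1 := by
      rw [coshSq_eq_trace h hy]
      nlinarith [sq_nonneg (c * y - s / y)]
    have h6 : Real.sqrt K ≤ K := Real.sqrt_le_left (by linarith) |>.mpr (by nlinarith)
    calc Real.sqrt K * (c ^ 2 * y ^ 2) = (c ^ 2 * y ^ 2) * Real.sqrt K := by ring
      _ ≤ (1 + c ^ 2 * y ^ 2) * (1 + K * (coshSq α δ c s y - 1)) := by
        gcongr
        · linarith
        · nlinarith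

theorem inv_coshSq_pow_le_of_trace_le_one (h : α * δ - c * s = 1) (hc : c ≠ 0) (hy : 0 < y)
    (K : ℕ) : (1 / coshSq α δ c s y) ^ (K + 3) ≤
      64 / ((1 + α ^ 2) * (1 + δ ^ 2) * c ^ 2) *
        (1 / y ^ 2 * (1 / (1 + K * ((c * y + s / y) ^ 2 / 4)))) := by
  refine (inv_coshSq_pow_le h hc hy K).trans ?_
  rw [div_mul_eq_div_div (64 : ℝ) _ (c ^ 2), div_mul_eq_mul_div (64 / _) (c ^ 2) _, mul_div_assoc]
  refine mul_le_mul_of_nonneg_left ?_ (by positivity)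
  have e : 1 / y ^ 2 * (1 / (1 + K * ((c * y + s / y) ^ 2 / 4))) / c ^ 2 =
      1 / (c ^ 2 * y ^ 2) * (1 / (1 + K * ((c * y + s / y) ^ 2 / 4))) := by field_simp
  rw [e]
  have h5 : (c * y + s / y) ^ 2 / 4 ≤ coshSq α δ c s y - 1 := by
    rw [coshSq_eq_one_add h hy]
    nlinarith [sq_nonneg (α - δ)]
  have hκ : 0 < c ^ 2 * y ^ 2 := by positivity
  have h6 : 0 < 1 + K * ((c * y + s / y) ^ 2 / 4) := by positivity
  refine mul_le_mul (by gcongr; linarith) (by gcongr) ?_ (by positivity)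
  refine one_div_nonneg.mpr (h6.le.trans ?_)
  gcongr

theorem setLIntegral_inv_coshSq_le (h : α * δ - c * s = 1) (hc : c ≠ 0) {K : ℕ} (hK : 1 ≤ K)
    {t : ℤ} (ht : α + δ = t) {Y : ℝ} (hY : 0 < Y) (T : ℝ) :
    ∫⁻ y in Ioo Y⁻¹ T, ENNReal.ofReal ((1 / coshSq α δ c s y) ^ (K + 3) * (1 / y)) ≤
      ENNReal.ofReal (448 * Y ^ 2 / Real.sqrt K * (1 / ((1 + α ^ 2) * (1 + δ ^ 2) * c ^ 2))) := by
  have hY' : 0 < Y⁻¹ := inv_pos.mpr hY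
  have hK0 : (0 : ℝ) < K := by exact_mod_cast hK
  have hsK : 0 < Real.sqrt K := Real.sqrt_pos.mpr hK0
  set W := 64 / ((1 + α ^ 2) * (1 + δ ^ 2) * c ^ 2) with hW
  have hW0 : 0 ≤ W := by positivity
  have hWe : 448 * Y ^ 2 / Real.sqrt K * (1 / ((1 + α ^ 2) * (1 + δ ^ 2) * c ^ 2)) =
      W * (7 * Y ^ 2 / Real.sqrt K) := by rw [hW]; field_simp; norm_num
  have hpos : ∀ y ∈ Ioo Y⁻¹ T, 0 < y := fun y hy ↦ hY'.trans hy.1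
  rw [hWe]
  rcases le_or_gt 2 |t| with ht2 | ht2
  · have ht' : |α + δ| = 2 ∨ 3 ≤ |α + δ| := by
      rw [ht]
      rcases ht2.eq_or_lt with h2 | h2
      · left; exact_mod_cast h2.symm
      · right; exact_mod_cast h2
    calc _ ≤ ∫⁻ y in Ioo Y⁻¹ T, ENNReal.ofReal (W * (1 / Real.sqrt K)) *
          ENNReal.ofReal (1 / y ^ 2 * (1 / y)) := by
          refine setLIntegral_mono' measurableSet_Ioo fun y hy ↦ ?_
          have hy0 := hpos y hy
          rw [← ENNReal.ofReal_mul (by positivity)]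
          refine ENNReal.ofReal_le_ofReal ?_
          have := inv_coshSq_pow_le_of_two_le_trace h hc hy0 hK ht'
          calc _ ≤ W * (1 / Real.sqrt K * (1 / y ^ 2)) * (1 / y) := by gcongr
            _ = _ := by ring
      _ = ENNReal.ofReal (W * (1 / Real.sqrt K)) * ∫⁻ y in Ioo Y⁻¹ T,
          ENNReal.ofReal (1 / y ^ 2 * (1 / y)) := lintegral_const_mul' _ _ ENNReal.ofReal_ne_top
      _ ≤ ENNReal.ofReal (W * (1 / Real.sqrt K)) * ENNReal.ofReal (1 / Y⁻¹ ^ 2) := by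
          gcongr; exact setLIntegral_inv_cube_le hY'
      _ ≤ _ := by
          rw [← ENNReal.ofReal_mul (by positivity)]
          refine ENNReal.ofReal_le_ofReal ?_
          rw [mul_assoc]
          refine mul_le_mul_of_nonneg_left ?_ hW0
          rw [inv_pow, one_div, one_div, inv_inv, inv_mul_eq_div]
          gcongr
          nlinarith [sq_nonneg Y]
  · have ht1 : (α + δ) ^ 2 ≤ 1 := by
      rw [ht]
      have : |t| ≤ 1 := by omega
      exact_mod_cast (sq_le_one_iff_abs_le_one t).mpr this
    -- 4αδ ≤ (α + δ)² ≤ 1, and cs = αδ - 1.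
    have hcs : c * s ≤ -(3 / 4) := by nlinarith [sq_nonneg (α - δ)]
    have hl : ∫⁻ y in Ioo Y⁻¹ T, ENNReal.ofReal
        (1 / (1 + K * ((c * y + s / y) ^ 2 / 4)) * (1 / y)) ≤
        ENNReal.ofReal (7 / Real.sqrt K) := by
      -- Changing the signs of both c and s preserves the Lorentzian, so c > 0 may be assumed.
      rcases hc.lt_or_gt with hc | hc
      · have := setLIntegral_lorentzian_le (a := Y⁻¹) (b := T) (c := -c) (s := -s) (K := K) hY'
          (by linarith) (by linarith) hK0
        have e : ∀ y, (-c * y + -s / y) ^ 2 = (c * y + s / y) ^ 2 := fun y ↦ by ring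
        simpa only [e] using this
      · exact setLIntegral_lorentzian_le hY' hc hcs hK0
    calc _ ≤ ∫⁻ y in Ioo Y⁻¹ T, ENNReal.ofReal (W * Y ^ 2) *
          ENNReal.ofReal (1 / (1 + K * ((c * y + s / y) ^ 2 / 4)) * (1 / y)) := by
          refine setLIntegral_mono' measurableSet_Ioo fun y hy ↦ ?_
          have hy0 := hpos y hy
          rw [← ENNReal.ofReal_mul (by positivity)]
          refine ENNReal.ofReal_le_ofReal ?_
          have h1 := inv_coshSq_pow_le_of_trace_le_one h hc hy0 K
          have h2 : 1 / y ^ 2 ≤ Y ^ 2 := by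
            rw [← one_div_pow, one_div]
            exact pow_le_pow_left₀ (by positivity) (inv_le_of_inv_le₀ hY hy.1.le) 2
          calc _ ≤ W * (1 / y ^ 2 * (1 / (1 + K * ((c * y + s / y) ^ 2 / 4)))) * (1 / y) := by
                gcongr
            _ ≤ W * (Y ^ 2 * (1 / (1 + K * ((c * y + s / y) ^ 2 / 4)))) * (1 / y) := by gcongr
            _ = _ := by ring
      _ = ENNReal.ofReal (W * Y ^ 2) * ∫⁻ y in Ioo Y⁻¹ T,
          ENNReal.ofReal (1 / (1 + K * ((c * y + s / y) ^ 2 / 4)) * (1 / y)) :=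
          lintegral_const_mul' _ _ ENNReal.ofReal_ne_top
      _ ≤ ENNReal.ofReal (W * Y ^ 2) * ENNReal.ofReal (7 / Real.sqrt K) := by gcongr
      _ = _ := by
          rw [← ENNReal.ofReal_mul (by positivity)]
          congr 1
          ring

end CoshSq

/-! ### Summation over SL₂(ℤ) -/

theorem exists_tsum_one_div_one_add_shift_sq_le :
    ∃ A : ℝ, 0 < A ∧ ∀ θ : ℝ, ∑' n : ℤ, ENNReal.ofReal (1 / (1 + (n + θ) ^ 2)) ≤
      ENNReal.ofReal A := by
  have hs := summable_one_div_one_add_int_sq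
  have h0 : 0 ≤ ∑' n : ℤ, 1 / (1 + (n : ℝ) ^ 2) := tsum_nonneg fun n ↦ by positivity
  refine ⟨3 * ∑' n : ℤ, 1 / (1 + (n : ℝ) ^ 2) + 1, by positivity, fun θ ↦ ?_⟩
  rw [← (Equiv.subRight ⌊θ⌋).tsum_eq]
  calc _ ≤ ∑' n : ℤ, ENNReal.ofReal (3 * (1 / (1 + (n : ℝ) ^ 2))) := by
        refine ENNReal.tsum_le_tsum fun n ↦ ENNReal.ofReal_le_ofReal ?_
        have e : ((Equiv.subRight ⌊θ⌋ n : ℤ) : ℝ) + θ = n + Int.fract θ := by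
          simp only [Equiv.subRight_apply, Int.cast_sub, Int.fract]; ring
        rw [e, mul_one_div, div_le_div_iff₀ (by positivity) (by positivity)]
        have h1 := Int.fract_nonneg θ
        have h2 := (Int.fract_lt_one θ).le
        have h3 : Int.fract θ ^ 2 ≤ 1 := pow_le_one₀ h1 h2
        linarith [sq_nonneg (n + 3 / 2 * Int.fract θ)]
    _ = ENNReal.ofReal (∑' n : ℤ, 3 * (1 / (1 + (n : ℝ) ^ 2))) :=
        (ENNReal.ofReal_tsum_of_nonneg (fun n ↦ by positivity) (hs.mul_left 3)).symm
    _ ≤ _ := by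
        rw [tsum_mul_left]
        exact ENNReal.ofReal_le_ofReal (by linarith)

/-- The term n = 0 is 1 / 0 = 0. -/
theorem exists_tsum_one_div_int_sq_le :
    ∃ Z : ℝ, 0 < Z ∧ ∑' n : ℤ, ENNReal.ofReal (1 / (n : ℝ) ^ 2) ≤ ENNReal.ofReal Z := by
  have hs := Real.summable_one_div_int_pow.mpr one_lt_two
  have h0 : 0 ≤ ∑' n : ℤ, 1 / (n : ℝ) ^ 2 := tsum_nonneg fun n ↦ by positivity
  refine ⟨∑' n : ℤ, 1 / (n : ℝ) ^ 2 + 1, by positivity, ?_⟩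
  rw [← ENNReal.ofReal_tsum_of_nonneg (fun n ↦ by positivity) hs]
  exact ENNReal.ofReal_le_ofReal (by linarith)

/-- For c ≠ 0 the determinant recovers b from (c, a, d), so the sum may be enlarged to all integer
triples. For fixed c the sums over a and d are shifted by ∓cx and bounded uniformly in x, leaving ∑
1/c². -/
theorem exists_tsum_nonzero_lower_left_le :
    ∃ C : ℝ, 0 < C ∧ ∀ x : ℝ, ∑' g : {g : SL(2, ℤ) // g 1 0 ≠ 0},
      ENNReal.ofReal (1 / ((1 + (g.1 0 0 - g.1 1 0 * x) ^ 2) *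
        (1 + (g.1 1 0 * x + g.1 1 1) ^ 2) * (g.1 1 0 : ℝ) ^ 2)) ≤ ENNReal.ofReal C := by
  obtain ⟨A, hA, hAb⟩ := exists_tsum_one_div_one_add_shift_sq_le
  obtain ⟨Z, hZ, hZb⟩ := exists_tsum_one_div_int_sq_le
  refine ⟨Z * (A * A), by positivity, fun x ↦ ?_⟩
  set F : ℤ × ℤ × ℤ → ENNReal := fun p ↦ ENNReal.ofReal (1 / (p.1 : ℝ) ^ 2) *
    (ENNReal.ofReal (1 / (1 + (p.2.1 + (-(p.1 * x))) ^ 2)) *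
      ENNReal.ofReal (1 / (1 + (p.2.2 + p.1 * x) ^ 2))) with hF
  set i : {g : SL(2, ℤ) // g 1 0 ≠ 0} → ℤ × ℤ × ℤ := fun g ↦ (g.1 1 0, g.1 0 0, g.1 1 1) with hi
  have hinj : Function.Injective i := by
    intro g g' h
    simp only [hi, Prod.mk.injEq] at h
    obtain ⟨hc, ha, hd⟩ := h
    have h1 := det_entries_eq_one g.1
    have h2 := det_entries_eq_one g'.1
    rw [hc, ha, hd] at h1
    have hb : g.1 0 1 = g'.1 0 1 := mul_right_cancel₀ g'.2 (by linarith)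
    ext a b
    fin_cases a <;> fin_cases b <;> simp [hc, ha, hd, hb]
  calc _ = ∑' g, F (i g) := by
        refine tsum_congr fun g ↦ ?_
        simp only [hF, hi]
        rw [← ENNReal.ofReal_mul (by positivity), ← ENNReal.ofReal_mul (by positivity)]
        congr 1
        rw [div_mul_div_comm, div_mul_div_comm]
        congr 1
        · norm_num
        · ring
    _ ≤ ∑' p, F p := ENNReal.tsum_comp_le_tsum_of_injective hinj F
    _ = ∑' c : ℤ, ENNReal.ofReal (1 / (c : ℝ) ^ 2) *
          ((∑' a : ℤ, ENNReal.ofReal (1 / (1 + (a + (-(c * x))) ^ 2))) *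
            ∑' d : ℤ, ENNReal.ofReal (1 / (1 + (d + c * x) ^ 2))) := by
        rw [ENNReal.tsum_prod']
        refine tsum_congr fun c ↦ ?_
        rw [ENNReal.tsum_prod']
        simp only [hF]
        rw [← ENNReal.tsum_mul_right, ← ENNReal.tsum_mul_left]
        refine tsum_congr fun a ↦ ?_
        rw [ENNReal.tsum_mul_left, ENNReal.tsum_mul_left]
    _ ≤ ∑' c : ℤ, ENNReal.ofReal (1 / (c : ℝ) ^ 2) * (ENNReal.ofReal A * ENNReal.ofReal A) := by
        refine ENNReal.tsum_le_tsum fun c ↦ ?_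
        gcongr
        · exact hAb _
        · exact hAb _
    _ ≤ ENNReal.ofReal Z * (ENNReal.ofReal A * ENNReal.ofReal A) := by
        rw [ENNReal.tsum_mul_right]
        gcongr
    _ = _ := by
        rw [← ENNReal.ofReal_mul hA.le, ← ENNReal.ofReal_mul hZ.le]

theorem diag_of_lower_left_eq_zero {g : SL(2, ℤ)} (hc : g 1 0 = 0) :
    (g 0 0 = 1 ∧ g 1 1 = 1) ∨ (g 0 0 = -1 ∧ g 1 1 = -1) := by
  have h := det_entries_eq_one g
  rw [hc, mul_zero, sub_zero] at h
  exact Int.mul_eq_one_iff_eq_one_or_neg_one.mp h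

theorem upper_right_ne_zero {g : SL(2, ℤ)} (hc : g 1 0 = 0) (h1 : g ≠ 1) (h2 : g ≠ -1) :
    g 0 1 ≠ 0 := by
  intro hb
  rcases diag_of_lower_left_eq_zero hc with ⟨ha, hd⟩ | ⟨ha, hd⟩
  · refine h1 ?_
    ext i j
    fin_cases i <;> fin_cases j <;> simp [ha, hb, hc, hd]
  · refine h2 ?_
    ext i j
    fin_cases i <;> fin_cases j <;> simp [ha, hb, hc, hd]

theorem exists_tsum_zero_lower_left_le :
    ∃ C : ℝ, 0 < C ∧ ∑' g : {g : SL(2, ℤ) // g 1 0 = 0 ∧ g ≠ 1 ∧ g ≠ -1},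
      ENNReal.ofReal (1 / (g.1 0 1 : ℝ) ^ 2) ≤ ENNReal.ofReal C := by
  obtain ⟨A, hA, hAb⟩ := exists_tsum_one_div_one_add_shift_sq_le
  obtain ⟨Z, hZ, hZb⟩ := exists_tsum_one_div_int_sq_le
  refine ⟨2 * (A * Z), by positivity, ?_⟩
  set F : ℤ × ℤ → ENNReal := fun p ↦ ENNReal.ofReal 2 *
    (ENNReal.ofReal (1 / (1 + (p.1 + 0) ^ 2)) * ENNReal.ofReal (1 / (p.2 : ℝ) ^ 2)) with hF
  set i : {g : SL(2, ℤ) // g 1 0 = 0 ∧ g ≠ 1 ∧ g ≠ -1} → ℤ × ℤ := fun g ↦ (g.1 0 0, g.1 0 1)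
    with hi
  have hinj : Function.Injective i := by
    intro g g' h
    simp only [hi, Prod.mk.injEq] at h
    obtain ⟨ha, hb⟩ := h
    have hd : g.1 1 1 = g'.1 1 1 := by
      have h1 := diag_of_lower_left_eq_zero g.2.1
      have h2 := diag_of_lower_left_eq_zero g'.2.1
      omega
    ext a b
    fin_cases a <;> fin_cases b <;> simp [ha, hb, hd, g.2.1, g'.2.1]
  calc _ = ∑' g, F (i g) := by
        refine tsum_congr fun g ↦ ?_
        simp only [hF, hi]
        rw [← ENNReal.ofReal_mul (by positivity), ← ENNReal.ofReal_mul (by positivity)]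
        congr 1
        have : ((g.1 0 0 : ℝ) + 0) ^ 2 = 1 := by
          rcases diag_of_lower_left_eq_zero g.2.1 with h | h <;> rw [h.1] <;> norm_num
        rw [this]
        ring
    _ ≤ ∑' p, F p := ENNReal.tsum_comp_le_tsum_of_injective hinj F
    _ = ENNReal.ofReal 2 * ((∑' a : ℤ, ENNReal.ofReal (1 / (1 + (a + 0) ^ 2))) *
          ∑' b : ℤ, ENNReal.ofReal (1 / (b : ℝ) ^ 2)) := by
        simp only [hF]
        rw [ENNReal.tsum_mul_left, ENNReal.tsum_prod']
        simp only [ENNReal.tsum_mul_left, ENNReal.tsum_mul_right]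
    _ ≤ ENNReal.ofReal 2 * (ENNReal.ofReal A * ENNReal.ofReal Z) := by
        gcongr
        exact hAb 0
    _ = _ := by
        rw [← ENNReal.ofReal_mul hA.le, ← ENNReal.ofReal_mul zero_le_two]

theorem eight_mul_log_le {k : ℝ} (hk : 256 ≤ k) : 8 * Real.log k ≤ k := by
  have h0 : 0 < Real.sqrt k := Real.sqrt_pos.mpr (by linarith)
  have h1 : Real.log k = 2 * Real.log (Real.sqrt k) := by
    rw [Real.log_sqrt (by linarith)]; ring
  have h2 := Real.log_le_sub_one_of_pos h0
  have h3 : Real.sqrt k ^ 2 = k := Real.sq_sqrt (by linarith)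
  have h4 : 16 ≤ Real.sqrt k := Real.le_sqrt_of_sq_le (by linarith)
  nlinarith

/-- With k = 2m and u₀ = 8 log k / k ≤ 1, log(1 + u₀) ≥ u₀/2 and m - 1 ≥ 3k/8, so (m - 1) log(1 +
u₀) ≥ (3/2) log k. -/
theorem inv_one_add_pow_le {m : ℕ} (hm : 128 ≤ m) {u : ℝ}
    (hu : 8 * Real.log (2 * m) / (2 * m) ≤ u) :
    (1 / (1 + u)) ^ (m - 1) ≤ 1 / ((2 * m) * Real.sqrt (2 * m)) := by
  have hm' : (128 : ℝ) ≤ m := by exact_mod_cast hm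
  set k : ℝ := 2 * m with hk
  have hk0 : 256 ≤ k := by linarith
  have hlog : 0 < Real.log k := Real.log_pos (by linarith)
  set u₀ := 8 * Real.log k / k with hu₀
  have h0 : 0 < u₀ := by positivity
  have h1 : u₀ ≤ 1 := (div_le_one (by linarith)).mpr (eight_mul_log_le hk0)
  have h2 : u₀ / 2 ≤ Real.log (1 + u₀) := by
    have := Real.one_sub_inv_le_log_of_pos (show 0 < 1 + u₀ by linarith)
    refine le_trans ?_ this
    have e : 1 - (1 + u₀)⁻¹ = u₀ / (1 + u₀) := by field_simp; ring
    rw [e]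
    gcongr
    linarith
  have h3 : k * Real.sqrt k ≤ (1 + u₀) ^ (m - 1) := by
    rw [← Real.log_le_log_iff (by positivity) (by positivity), Real.log_pow,
      Real.log_mul (by positivity) (by positivity), Real.log_sqrt (by positivity),
      Nat.cast_sub (by omega)]
    have h4 : k * u₀ = 8 * Real.log k := by rw [hu₀]; field_simp
    have h5 : 3 / 8 * k ≤ (m : ℝ) - 1 := by linarith
    calc Real.log k + Real.log k / 2 = 3 / 8 * k * (u₀ / 2) := by linarith
      _ ≤ ((m : ℝ) - (1 : ℕ)) * Real.log (1 + u₀) := by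
        push_cast
        have h6 : 0 ≤ (m : ℝ) - 1 := by linarith
        gcongr
  rw [div_pow, one_pow]
  refine one_div_le_one_div_of_le (by positivity) (h3.trans ?_)
  gcongr

/-- One of the m factors is set aside for the decay 1/b²; the other m - 1 give k^(-3/2). -/
theorem inv_coshSq_translation_le {m : ℕ} (hm : 128 ≤ m) {b y : ℝ} (hb : 1 ≤ b ^ 2) (hy : 0 < y)
    (hT : 8 * Real.log (2 * m) / (2 * m) ≤ 1 / (4 * y ^ 2)) :
    (1 / (1 + b ^ 2 / (4 * y ^ 2))) ^ m * (1 / y) ≤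
      4 / ((2 * m) * Real.sqrt (2 * m)) * (1 / b ^ 2) * y := by
  have h1 : 1 / (4 * y ^ 2) ≤ b ^ 2 / (4 * y ^ 2) := by gcongr
  have h2 := inv_one_add_pow_le hm (hT.trans h1)
  have h3 : 1 / (1 + b ^ 2 / (4 * y ^ 2)) ≤ 4 * y ^ 2 / b ^ 2 := by
    rw [div_le_div_iff₀ (by positivity) (by positivity)]
    have : 4 * y ^ 2 * (1 + b ^ 2 / (4 * y ^ 2)) = 4 * y ^ 2 + b ^ 2 := by field_simp
    rw [this]
    nlinarith
  have e : m = (m - 1) + 1 := by omega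
  rw [e, pow_succ, ← e]
  calc _ ≤ 1 / ((2 * m) * Real.sqrt (2 * m)) * (4 * y ^ 2 / b ^ 2) * (1 / y) := by gcongr
    _ = _ := by field_simp

/-- The value of `cosh²` at half the hyperbolic distance from `x + iy` to its image under `g`. -/
noncomputable def displacement (g : SL(2, ℤ)) (x y : ℝ) : ℝ :=
  coshSq (g 0 0 - g 1 0 * x) (g 1 0 * x + g 1 1) (g 1 0)
    ((g 0 0 - g 1 0 * x) * x + (g 0 1 - g 1 1 * x)) y

theorem displacement_det (g : SL(2, ℤ)) (x : ℝ) :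
    (g 0 0 - g 1 0 * x : ℝ) * (g 1 0 * x + g 1 1) -
      g 1 0 * ((g 0 0 - g 1 0 * x) * x + (g 0 1 - g 1 1 * x)) = 1 := by
  have h : (g 0 0 * g 1 1 - g 0 1 * g 1 0 : ℝ) = 1 := by exact_mod_cast det_entries_eq_one g
  linear_combination h

theorem norm_kernelDenom_diag_sq (g : SL(2, ℤ)) (x : ℝ) {y : ℝ} (hy : 0 < y) {z : ℂ}
    (hre : z.re = x) (him : z.im = y) :
    ‖kernelDenom g z z‖ ^ 2 = (2 * y) ^ 2 * displacement g x y := by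
  rw [norm_kernelDenom_sq, hre, him, displacement, coshSq]
  field_simp
  ring

theorem setLIntegral_displacement_of_lower_left_ne_zero {m : ℕ} (hm : 128 ≤ m) (x : ℝ)
    {Y : ℝ} (hY : 0 < Y) (T : ℝ) {g : SL(2, ℤ)} (hg : g 1 0 ≠ 0) :
    ∫⁻ y in Ioo Y⁻¹ T, ENNReal.ofReal ((1 / displacement g x y) ^ m * (1 / y)) ≤
      ENNReal.ofReal (896 * Y ^ 2 / Real.sqrt (2 * m)) *
        ENNReal.ofReal (1 / ((1 + (g 0 0 - g 1 0 * x) ^ 2) *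
        (1 + (g 1 0 * x + g 1 1) ^ 2) * (g 1 0 : ℝ) ^ 2)) := by
  obtain ⟨K, rfl⟩ := Nat.exists_eq_add_of_le' (show 3 ≤ m by omega)
  have h := setLIntegral_inv_coshSq_le (displacement_det g x) (by exact_mod_cast hg)
    (show 1 ≤ K by omega) (t := g 0 0 + g 1 1) (by push_cast; ring) hY T
  refine h.trans ?_
  rw [← ENNReal.ofReal_mul (by positivity)]
  refine ENNReal.ofReal_le_ofReal (mul_le_mul_of_nonneg_right ?_ (by positivity))
  have hK : (125 : ℝ) ≤ K := by exact_mod_cast (show 125 ≤ K by omega)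
  -- 2m = 2K + 6 ≤ 4K, so passing from √K to √(2m) doubles 448 to 896.
  have h2 : Real.sqrt (2 * ((K + 3 : ℕ) : ℝ)) ≤ 2 * Real.sqrt K := by
    refine Real.sqrt_le_left (by positivity) |>.mpr ?_
    rw [mul_pow, Real.sq_sqrt (by linarith)]
    push_cast
    linarith
  rw [div_le_div_iff₀ (by positivity) (by positivity)]
  calc 448 * Y ^ 2 * Real.sqrt (2 * ((K + 3 : ℕ) : ℝ)) ≤ 448 * Y ^ 2 * (2 * Real.sqrt K) := by gcongr
    _ = _ := by ring

theorem displacement_of_lower_left_eq_zero {g : SL(2, ℤ)} (hg : g 1 0 = 0) (x : ℝ) {y : ℝ}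
    (hy : 0 < y) : displacement g x y = 1 + (g 0 1 : ℝ) ^ 2 / (4 * y ^ 2) := by
  rw [displacement, coshSq, hg]
  rcases diag_of_lower_left_eq_zero hg with ⟨ha, hd⟩ | ⟨ha, hd⟩ <;>
  · rw [ha, hd]
    field_simp
    push_cast
    ring

/-- For y < T the constant 34 gives 1/(4y²) ≥ (34/4) log k / k, above the required 8 log k / k. The
remaining integral of y is at most T² ≤ k/4, which turns k^(-3/2) into k^(-1/2). -/
theorem setLIntegral_displacement_of_lower_left_eq_zero {m : ℕ} (hm : 128 ≤ m) (x : ℝ)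
    {Y T : ℝ} (hY : 0 < Y) (hT : T ^ 2 ≤ (2 * m) / (34 * Real.log (2 * m))) {g : SL(2, ℤ)}
    (hg : g 1 0 = 0) (h1 : g ≠ 1) (h2 : g ≠ -1) :
    ∫⁻ y in Ioo Y⁻¹ T, ENNReal.ofReal ((1 / displacement g x y) ^ m * (1 / y)) ≤
      ENNReal.ofReal (1 / Real.sqrt (2 * m)) * ENNReal.ofReal (1 / (g 0 1 : ℝ) ^ 2) := by
  have hY' : 0 < Y⁻¹ := inv_pos.mpr hY
  have hm' : (128 : ℝ) ≤ m := by exact_mod_cast hm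
  set k : ℝ := 2 * m with hk
  have hk0 : 256 ≤ k := by linarith
  have hlog1 : 1 ≤ Real.log k := by
    rw [Real.le_log_iff_exp_le (by linarith)]
    linarith [Real.exp_one_lt_d9]
  have hb : 1 ≤ (g 0 1 : ℝ) ^ 2 := by
    have := upper_right_ne_zero hg h1 h2
    exact_mod_cast Int.one_le_abs (pow_ne_zero 2 this) |>.trans (by rw [abs_of_nonneg (sq_nonneg _)])
  have hTk : 4 * T ^ 2 ≤ k := by
    calc 4 * T ^ 2 ≤ 4 * (k / (34 * Real.log k)) := by gcongr
      _ ≤ 4 * (k / 34) := by gcongr; linarith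
      _ ≤ k := by linarith
  calc _ ≤ ∫⁻ y in Ioo Y⁻¹ T, ENNReal.ofReal (4 / (k * Real.sqrt k) * (1 / (g 0 1 : ℝ) ^ 2)) *
        ENNReal.ofReal y := by
        refine setLIntegral_mono' measurableSet_Ioo fun y hy ↦ ?_
        have hy0 : 0 < y := hY'.trans hy.1
        rw [← ENNReal.ofReal_mul (by positivity), displacement_of_lower_left_eq_zero hg x hy0]
        refine ENNReal.ofReal_le_ofReal (inv_coshSq_translation_le hm hb hy0 ?_)
        have hyT : y ^ 2 ≤ k / (34 * Real.log k) :=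
          (pow_le_pow_left₀ hy0.le hy.2.le 2).trans hT
        rw [← hk, div_le_div_iff₀ (by linarith) (by positivity)]
        calc 8 * Real.log k * (4 * y ^ 2) ≤ 8 * Real.log k * (4 * (k / (34 * Real.log k))) := by
              gcongr
          _ = 32 / 34 * k := by field_simp; norm_num
          _ ≤ 1 * k := by linarith
    _ = ENNReal.ofReal (4 / (k * Real.sqrt k) * (1 / (g 0 1 : ℝ) ^ 2)) *
        ∫⁻ y in Ioo Y⁻¹ T, ENNReal.ofReal y := lintegral_const_mul' _ _ ENNReal.ofReal_ne_top
    _ ≤ ENNReal.ofReal (4 / (k * Real.sqrt k) * (1 / (g 0 1 : ℝ) ^ 2)) *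
        ENNReal.ofReal (T ^ 2) := by gcongr; exact setLIntegral_id_le hY'
    _ ≤ _ := by
        rw [← ENNReal.ofReal_mul (by positivity), ← ENNReal.ofReal_mul (by positivity)]
        refine ENNReal.ofReal_le_ofReal ?_
        calc 4 / (k * Real.sqrt k) * (1 / (g 0 1 : ℝ) ^ 2) * T ^ 2 =
              (4 * T ^ 2) / (k * Real.sqrt k) * (1 / (g 0 1 : ℝ) ^ 2) := by ring
          _ ≤ k / (k * Real.sqrt k) * (1 / (g 0 1 : ℝ) ^ 2) := by gcongr
          _ = _ := by field_simp

theorem measurable_displacement (g : SL(2, ℤ)) (x : ℝ) : Measurable (displacement g x) := by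
  unfold displacement coshSq
  fun_prop

theorem exists_setLIntegral_tsum_displacement_le : ∃ C : ℝ, 0 < C ∧
    ∀ (m : ℕ) (x Y T : ℝ), 128 ≤ m → 1 ≤ Y → T ^ 2 ≤ (2 * m) / (34 * Real.log (2 * m)) →
      ∫⁻ y in Ioo Y⁻¹ T, ∑' g : {g : SL(2, ℤ) // g ∉ ({1, -1} : Finset SL(2, ℤ))},
        ENNReal.ofReal ((1 / displacement g x y) ^ m * (1 / y)) ≤
      ENNReal.ofReal (C * (Y ^ 2 / Real.sqrt (2 * m))) := by
  obtain ⟨C₁, hC₁, hb₁⟩ := exists_tsum_nonzero_lower_left_le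
  obtain ⟨C₂, hC₂, hb₂⟩ := exists_tsum_zero_lower_left_le
  refine ⟨896 * C₁ + C₂, by positivity, fun m x Y T hm hY hT ↦ ?_⟩
  have hY0 : 0 < Y := by linarith
  have hm0 : 0 < Real.sqrt (2 * m) := Real.sqrt_pos.mpr (by positivity)
  have hmeas : ∀ g : {g : SL(2, ℤ) // g ∉ ({1, -1} : Finset SL(2, ℤ))}, AEMeasurable (fun y ↦
      ENNReal.ofReal ((1 / displacement g x y) ^ m * (1 / y))) (volume.restrict (Ioo Y⁻¹ T)) :=
    fun g ↦ ((((measurable_displacement g x).const_div 1).pow_const m).mul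
      (measurable_id.const_div 1)).ennreal_ofReal.aemeasurable
  rw [lintegral_tsum hmeas]
  set I : SL(2, ℤ) → ENNReal := fun g ↦
    ∫⁻ y in Ioo Y⁻¹ T, ENNReal.ofReal ((1 / displacement g x y) ^ m * (1 / y)) with hI
  have hsub : {g : SL(2, ℤ) | g ∉ ({1, -1} : Finset SL(2, ℤ))} ⊆
      {g | g 1 0 ≠ 0} ∪ {g | g 1 0 = 0 ∧ g ≠ 1 ∧ g ≠ -1} := by
    intro g hg
    simp only [Finset.mem_insert, Finset.mem_singleton, not_or, mem_ofPred_eq] at hg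
    by_cases h : g 1 0 = 0
    · exact Or.inr ⟨h, hg⟩
    · exact Or.inl h
  calc _ ≤ ∑' g : ({g | g 1 0 ≠ 0} ∪ {g | g 1 0 = 0 ∧ g ≠ 1 ∧ g ≠ -1} : Set SL(2, ℤ)), I g :=
        ENNReal.tsum_mono_subtype I hsub
    _ ≤ ∑' g : ({g | g 1 0 ≠ 0} : Set SL(2, ℤ)), I g +
        ∑' g : ({g | g 1 0 = 0 ∧ g ≠ 1 ∧ g ≠ -1} : Set SL(2, ℤ)), I g :=
        ENNReal.tsum_union_le I _ _
    _ ≤ ENNReal.ofReal (896 * Y ^ 2 / Real.sqrt (2 * m)) * ENNReal.ofReal C₁ +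
        ENNReal.ofReal (1 / Real.sqrt (2 * m)) * ENNReal.ofReal C₂ := by
        refine add_le_add ?_ ?_
        · refine (ENNReal.tsum_le_tsum fun g ↦
            setLIntegral_displacement_of_lower_left_ne_zero hm x hY0 T g.2).trans ?_
          rw [ENNReal.tsum_mul_left]
          gcongr
          exact hb₁ x
        · refine (ENNReal.tsum_le_tsum fun g ↦
            setLIntegral_displacement_of_lower_left_eq_zero hm x hY0 hT g.2.1 g.2.2.1
              g.2.2.2).trans ?_
          rw [ENNReal.tsum_mul_left]
          gcongr
          exact hb₂
    _ ≤ _ := by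
        rw [← ENNReal.ofReal_mul (by positivity), ← ENNReal.ofReal_mul (by positivity),
          ← ENNReal.ofReal_add (by positivity) (by positivity)]
        refine ENNReal.ofReal_le_ofReal ?_
        have h1 : 1 / Real.sqrt (2 * m) ≤ Y ^ 2 / Real.sqrt (2 * m) := by
          gcongr
          nlinarith
        calc _ = 896 * C₁ * (Y ^ 2 / Real.sqrt (2 * m)) + C₂ * (1 / Real.sqrt (2 * m)) := by ring
          _ ≤ 896 * C₁ * (Y ^ 2 / Real.sqrt (2 * m)) + C₂ * (Y ^ 2 / Real.sqrt (2 * m)) := by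
            gcongr
          _ = _ := by ring

end

/-! ### Comparison of the densities and the final estimate -/

section

open MeasureTheory Set Metric
open scoped UpperHalfPlane

/-- The constant 23 covers both cases of the level one dimension formula. -/
theorem card_basis_cuspForm_bounds {k : ℕ} (hk : 3 ≤ k) (hk2 : Even k) {ι : Type} [Fintype ι]
    (B : Module.Basis ι ℂ (CuspForm 𝒮ℒ (k : ℤ))) :
    12 * Fintype.card ι ≤ k ∧ k ≤ 12 * Fintype.card ι + 23 := by
  have h1 := ModularForm.rank_eq_one_add_rank_cuspForm hk hk2
  rw [ModularForm.dimension_level_one k hk2, rank_eq_card_basis B] at h1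
  split_ifs at h1 with h
  · have h2 : k / 12 = 1 + Fintype.card ι := by exact_mod_cast h1
    omega
  · have h2 : k / 12 + 1 = 1 + Fintype.card ι := by exact_mod_cast h1
    omega

theorem kernelDenom_one_diag (w : ℍ) : kernelDenom 1 w w = 2 * Complex.I * w.im := by
  have := sub_conj_eq_two_im_mul_I (w : ℂ)
  simp only [UpperHalfPlane.coe_im] at this
  simp only [kernelDenom, Matrix.SpecialLinearGroup.coe_one, Matrix.one_apply_eq, ne_eq,
    zero_ne_one, not_false_eq_true, Matrix.one_apply_ne, one_ne_zero, Int.cast_one, Int.cast_zero]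
  linear_combination this

theorem kernelDenom_neg_one_diag (w : ℍ) : kernelDenom (-1) w w = -(2 * Complex.I * w.im) := by
  rw [← kernelDenom_one_diag]
  simp [kernelDenom]
  ring

theorem norm_im_pow_mul_kernel_term (m : ℕ) (w : ℍ) (g : SL(2, ℤ)) :
    ‖(w.im : ℂ) ^ (2 * m) * (2 * Complex.I / kernelDenom g w w) ^ (2 * m)‖ =
      (1 / displacement g w.re w.im) ^ m := by
  have hy := w.im_pos
  have h := norm_kernelDenom_diag_sq g w.re hy (z := w) rfl rfl
  have h0 : 0 < ‖kernelDenom g w w‖ := norm_pos_iff.mpr (kernelDenom_ne_zero g hy hy)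
  rw [← mul_pow, norm_pow, pow_mul, norm_mul, norm_div, norm_mul, Complex.norm_I,
    Complex.norm_real, Real.norm_of_nonneg hy.le, Complex.norm_ofNat, mul_one, mul_pow, div_pow, h]
  congr 1
  field_simp

theorem summable_inv_displacement_pow {m : ℕ} (hm : 4 ≤ m) (w : ℍ) :
    Summable fun g : SL(2, ℤ) ↦ (1 / displacement g w.re w.im) ^ m := by
  have h := (summable_kernel_term w.im_pos w.im_pos (show 8 ≤ 2 * m by omega)).mul_left
    (‖(w.im : ℂ) ^ (2 * m)‖)
  refine h.congr fun g ↦ ?_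
  rw [← norm_mul]
  exact norm_im_pow_mul_kernel_term m w g

/-- The terms g = ±1 equal (±1)^(2m) = 1 each. -/
theorem norm_im_pow_mul_kernelSeries_sub_two_le {m : ℕ} (hm : 4 ≤ m) (w : ℍ) :
    ‖(w.im : ℂ) ^ (2 * m) * kernelSeries (2 * m) w w - 2‖ ≤
      ∑' g : {g : SL(2, ℤ) // g ∉ ({1, -1} : Finset SL(2, ℤ))},
        (1 / displacement g w.re w.im) ^ m := by
  have hs : Summable fun g : SL(2, ℤ) ↦
      (w.im : ℂ) ^ (2 * m) * (2 * Complex.I / kernelDenom g w w) ^ (2 * m) := by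
    refine Summable.of_norm ((summable_inv_displacement_pow hm w).congr fun g ↦ ?_)
    exact (norm_im_pow_mul_kernel_term m w g).symm
  have hne : (1 : SL(2, ℤ)) ≠ -1 := by
    intro h
    have h2 := congrArg (fun A : SL(2, ℤ) ↦ A 0 0) h
    simp at h2
  have hy : (w.im : ℂ) ≠ 0 := by exact_mod_cast w.im_ne_zero
  have h1 : (w.im : ℂ) * (2 * Complex.I / kernelDenom 1 w w) = 1 := by
    rw [kernelDenom_one_diag]
    have := Complex.I_ne_zero
    field_simp
  have h2 : (w.im : ℂ) * (2 * Complex.I / kernelDenom (-1) w w) = -1 := by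
    rw [kernelDenom_neg_one_diag]
    have := Complex.I_ne_zero
    field_simp
  have h := hs.sum_add_tsum_subtype_compl {1, -1}
  rw [Finset.sum_pair hne, ← mul_pow, ← mul_pow, h1, h2, one_pow,
    (even_two_mul m).neg_one_pow] at h
  rw [kernelSeries, ← tsum_mul_left, ← h]
  have e : (1 : ℂ) + 1 = 2 := by norm_num
  rw [e, add_sub_cancel_left]
  refine tsum_of_norm_bounded
    ((summable_inv_displacement_pow hm w).subtype _).hasSum fun g ↦ ?_
  exact (norm_im_pow_mul_kernel_term m w g).le

theorem abs_averagedDensity_sub_le {m : ℕ} (hm : 128 ≤ m) {ι : Type} [Fintype ι]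
    {B : Module.Basis ι ℂ (CuspForm 𝒮ℒ ((2 * m : ℕ) : ℤ))} (hB : IsPeterssonOrthonormal B)
    (x : ℝ) {y : ℝ} (hy : 0 < y) :
    ENNReal.ofReal |averagedDensity B x y - 3 / Real.pi| ≤ ENNReal.ofReal (46 / (2 * m)) +
      ∑' g : {g : SL(2, ℤ) // g ∉ ({1, -1} : Finset SL(2, ℤ))},
        ENNReal.ofReal ((1 / displacement g x y) ^ m) := by
  set w : ℍ := UpperHalfPlane.ofComplex ((x : ℂ) + (y : ℂ) * Complex.I) with hw
  have hwe : (w : ℂ) = (x : ℂ) + (y : ℂ) * Complex.I := by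
    rw [hw, UpperHalfPlane.ofComplex_apply_of_im_pos (by simpa using hy)]
  have hre : w.re = x := by rw [← UpperHalfPlane.coe_re, hwe]; simp
  have him : w.im = y := by rw [← UpperHalfPlane.coe_im, hwe]; simp
  have h1 := norm_im_pow_mul_kernelSeries_sub_two_le (show 4 ≤ m by omega) w
  have hs := (summable_inv_displacement_pow (show 4 ≤ m by omega) w).subtype
    {g | g ∉ ({1, -1} : Finset SL(2, ℤ))}
  obtain ⟨hN1, hN2⟩ := card_basis_cuspForm_bounds (by omega) (even_two_mul m) B
  rw [kernelSeries_diag_eq (by omega) hB] at h1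
  rw [hre, him] at h1 hs
  set S := ∑' g : {g : SL(2, ℤ) // g ∉ ({1, -1} : Finset SL(2, ℤ))},
        (1 / displacement g x y) ^ m with hS
  have hdpos : ∀ g : SL(2, ℤ), 0 ≤ (1 / displacement g x y) ^ m := by
    intro g
    have := one_le_coshSq (displacement_det g x) hy
    have : 0 ≤ displacement g x y := zero_le_one.trans this
    positivity
  have hST : ENNReal.ofReal S = ∑' g : {g : SL(2, ℤ) // g ∉ ({1, -1} : Finset SL(2, ℤ))},
        ENNReal.ofReal ((1 / displacement g x y) ^ m) :=
    ENNReal.ofReal_tsum_of_nonneg (fun g ↦ hdpos g) hs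
  have hS0 : 0 ≤ S := tsum_nonneg fun g ↦ hdpos g
  rw [← hST, ← ENNReal.ofReal_add (by positivity) hS0]
  refine ENNReal.ofReal_le_ofReal ?_
  set N : ℝ := (Fintype.card ι : ℝ) with hN
  set k : ℝ := 2 * m with hk
  have hk256 : (256 : ℝ) ≤ k := by
    have : (128 : ℝ) ≤ m := by exact_mod_cast hm
    linarith
  have hN1' : 12 * N ≤ k := by rw [hk, hN]; exact_mod_cast hN1
  have hN2' : k ≤ 12 * N + 23 := by rw [hk, hN]; exact_mod_cast hN2
  have hN0 : 0 < N := by linarith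
  have hπ := Real.pi_gt_three
  have hπ0 := Real.pi_pos
  set Q : ℝ := y ^ (2 * m) * ∑ i, ‖B i w‖ ^ 2 with hQ
  have havg : averagedDensity B x y = Q / N := by
    rw [averagedDensity, ← Finset.mul_sum, ← hw, ← hQ, ← hN, inv_mul_eq_div]
  have h3 : |8 * Real.pi / (k - 1) * Q - 2| ≤ S := by
    refine le_trans (le_of_eq ?_) h1
    rw [← Real.norm_eq_abs, ← Complex.norm_real]
    congr 1
    rw [hQ, hk]
    push_cast
    ring
  have hk1 : 0 < k - 1 := by linarith
  -- The first summand is the error of the kernel, with coefficient at most 1; the second is the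
  -- error in replacing the dimension N by (k - 1)/12.
  have e : Q / N - 3 / Real.pi = (k - 1) / (8 * Real.pi * N) * (8 * Real.pi / (k - 1) * Q - 2) +
      (k - 1 - 12 * N) / (4 * Real.pi * N) := by
    field_simp
    ring
  have h4 : (k - 1) / (8 * Real.pi * N) ≤ 1 := by
    rw [div_le_one (by positivity)]
    nlinarith
  have h5 : |(k - 1 - 12 * N) / (4 * Real.pi * N)| ≤ 46 / k := by
    rw [abs_div, abs_of_pos (show 0 < 4 * Real.pi * N by positivity),
      div_le_div_iff₀ (by positivity) (by positivity)]
    have h6 : |k - 1 - 12 * N| ≤ 23 := abs_le.mpr ⟨by linarith, by linarith⟩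
    have h7 : 6 * N ≤ 2 * Real.pi * N := by nlinarith
    calc |k - 1 - 12 * N| * k ≤ 23 * k := by gcongr
      _ ≤ 46 * (4 * Real.pi * N) := by linarith
  rw [havg, e]
  refine (abs_add_le _ _).trans ?_
  rw [abs_mul, abs_of_nonneg (show 0 ≤ (k - 1) / (8 * Real.pi * N) by positivity)]
  have h8 : (k - 1) / (8 * Real.pi * N) * |8 * Real.pi / (k - 1) * Q - 2| ≤ 1 * S := by gcongr
  linarith

/-- The dimension error is integrated trivially: 1/y ≤ Y on an interval of length at most √k gives
46 Y / √k. -/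
theorem exists_setLIntegral_averagedDensity_sub_le : ∃ C : ℝ, 0 < C ∧
    ∀ (m : ℕ) (x Y T : ℝ), 128 ≤ m → 1 ≤ Y → 0 ≤ T →
      T ^ 2 ≤ (2 * m) / (34 * Real.log (2 * m)) →
      ∀ (ι : Type) [Fintype ι] (B : Module.Basis ι ℂ (CuspForm 𝒮ℒ ((2 * m : ℕ) : ℤ))),
        IsPeterssonOrthonormal B →
      ∫⁻ y in Ioo Y⁻¹ T, ENNReal.ofReal (|averagedDensity B x y - 3 / Real.pi| * (1 / y)) ≤
        ENNReal.ofReal (C * (Y ^ 2 / Real.sqrt (2 * m))) := by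
  obtain ⟨C, hC, hCb⟩ := exists_setLIntegral_tsum_displacement_le
  refine ⟨46 + C, by positivity, fun m x Y T hm hY hT0 hT ι _ B hB ↦ ?_⟩
  have hY' : 0 < Y⁻¹ := inv_pos.mpr (by linarith)
  have hm' : (128 : ℝ) ≤ m := by exact_mod_cast hm
  set k : ℝ := 2 * m with hk
  have hk0 : 256 ≤ k := by linarith
  have hTk : T ≤ Real.sqrt k := by
    refine Real.le_sqrt_of_sq_le (hT.trans ?_)
    have hlog1 : 1 ≤ Real.log k := by
      rw [Real.le_log_iff_exp_le (by linarith)]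
      linarith [Real.exp_one_lt_d9]
    exact div_le_self (by linarith) (by linarith)
  have hsk : Real.sqrt k * Real.sqrt k = k := Real.mul_self_sqrt (by linarith)
  have hsk0 : 0 < Real.sqrt k := Real.sqrt_pos.mpr (by linarith)
  calc _ ≤ ∫⁻ y in Ioo Y⁻¹ T, (ENNReal.ofReal (46 / k * Y) +
        ∑' g : {g : SL(2, ℤ) // g ∉ ({1, -1} : Finset SL(2, ℤ))},
          ENNReal.ofReal ((1 / displacement g x y) ^ m * (1 / y))) := by
        refine setLIntegral_mono' measurableSet_Ioo fun y hy ↦ ?_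
        have hy0 : 0 < y := hY'.trans hy.1
        rw [ENNReal.ofReal_mul (abs_nonneg _)]
        have hy1 : 1 / y ≤ Y := by
          rw [one_div]; exact inv_le_of_inv_le₀ (by linarith) hy.1.le
        calc _ ≤ (ENNReal.ofReal (46 / k) +
              ∑' g : {g : SL(2, ℤ) // g ∉ ({1, -1} : Finset SL(2, ℤ))},
                ENNReal.ofReal ((1 / displacement g x y) ^ m)) * ENNReal.ofReal (1 / y) := by
              gcongr
              exact abs_averagedDensity_sub_le hm hB x hy0
          _ = ENNReal.ofReal (46 / k * (1 / y)) +
              ∑' g : {g : SL(2, ℤ) // g ∉ ({1, -1} : Finset SL(2, ℤ))},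
                ENNReal.ofReal ((1 / displacement g x y) ^ m * (1 / y)) := by
              rw [add_mul, ← ENNReal.ofReal_mul (by positivity), ← ENNReal.tsum_mul_right]
              congr 1
              refine tsum_congr fun g ↦ ?_
              rw [← ENNReal.ofReal_mul' (by positivity)]
          _ ≤ _ := by gcongr
    _ = ENNReal.ofReal (46 / k * Y) * volume (Ioo Y⁻¹ T) + ∫⁻ y in Ioo Y⁻¹ T,
        ∑' g : {g : SL(2, ℤ) // g ∉ ({1, -1} : Finset SL(2, ℤ))},
          ENNReal.ofReal ((1 / displacement g x y) ^ m * (1 / y)) := by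
        rw [lintegral_add_left measurable_const, setLIntegral_const]
    _ ≤ ENNReal.ofReal (46 / k * Y) * ENNReal.ofReal (Real.sqrt k) +
        ENNReal.ofReal (C * (Y ^ 2 / Real.sqrt k)) := by
        rw [Real.volume_Ioo]
        gcongr
        · linarith
        · exact hCb m x Y T hm hY hT
    _ ≤ _ := by
        rw [← ENNReal.ofReal_mul (by positivity), ← ENNReal.ofReal_add (by positivity)
          (by positivity)]
        refine ENNReal.ofReal_le_ofReal ?_
        have e1 : 46 / k * Y * Real.sqrt k = 46 * (Y / Real.sqrt k) := by
          rw [← hsk, Real.sqrt_mul_self hsk0.le]; field_simp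
        have e2 : Y / Real.sqrt k ≤ Y ^ 2 / Real.sqrt k := by
          gcongr
          nlinarith
        rw [e1, add_mul]
        gcongr

theorem continuousOn_averagedDensity {k : ℕ} {ι : Type*} [Fintype ι]
    (B : Module.Basis ι ℂ (CuspForm 𝒮ℒ (k : ℤ))) (x : ℝ) :
    ContinuousOn (averagedDensity B x) (Ioi 0) := by
  refine continuousOn_const.mul (continuousOn_finsetSum _ fun i _ ↦ ?_)
  refine (continuousOn_id.pow k).mul (ContinuousOn.pow (ContinuousOn.norm ?_) 2)
  have h := (UpperHalfPlane.mdifferentiable_iff.mp (B i).holo').continuousOn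
  refine h.comp (f := fun y : ℝ ↦ (x : ℂ) + (y : ℂ) * Complex.I) (by fun_prop) fun y hy ↦ ?_
  simpa using hy

theorem integral_multiplicativeMeasure (f : ℝ → ℂ) :
    ∫ y, f y ∂multiplicativeMeasure = ∫ y in Ioi 0, (1 / y) • f y := by
  rw [multiplicativeMeasure, integral_withDensity_eq_integral_toReal_smul₀
    (by fun_prop) (ae_of_all _ fun _ ↦ ENNReal.ofReal_lt_top)]
  refine setIntegral_congr_fun measurableSet_Ioi fun y hy ↦ ?_
  have hy' : 0 ≤ 1 / y := (one_div_pos.mpr hy).le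
  simp only [ENNReal.toReal_ofReal hy']

theorem averagedDensity_nonneg {k : ℕ} {ι : Type*} [Fintype ι]
    (B : Module.Basis ι ℂ (CuspForm 𝒮ℒ (k : ℤ))) (x : ℝ) {y : ℝ} (hy : 0 < y) :
    0 ≤ averagedDensity B x y := by
  unfold averagedDensity
  positivity

theorem integral_averagedVerticalMeasure {k : ℕ} {ι : Type*} [Fintype ι]
    (B : Module.Basis ι ℂ (CuspForm 𝒮ℒ (k : ℤ))) (x : ℝ) (f : ℝ → ℂ) :
    ∫ y, f y ∂averagedVerticalMeasure B x =
      ∫ y in Ioi 0, (1 / y) • averagedDensity B x y • f y := by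
  have hm : AEMeasurable (fun y ↦ ENNReal.ofReal (averagedDensity B x y))
      multiplicativeMeasure :=
    (((continuousOn_averagedDensity B x).aemeasurable measurableSet_Ioi).ennreal_ofReal).mono_ac
      (withDensity_absolutelyContinuous _ _)
  rw [averagedVerticalMeasure, integral_withDensity_eq_integral_toReal_smul₀ hm
    (ae_of_all _ fun _ ↦ ENNReal.ofReal_lt_top), integral_multiplicativeMeasure]
  refine setIntegral_congr_fun measurableSet_Ioi fun y hy ↦ ?_
  simp only [ENNReal.toReal_ofReal (averagedDensity_nonneg B x hy)]

theorem integrableOn_smul_of_tsupport_subset {f : ℝ → ℝ} {ψ : ℝ → ℂ} {s : Set ℝ}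
    (hf : ContinuousOn f s) (hψ : Continuous ψ) (hc : HasCompactSupport ψ)
    (hs : tsupport ψ ⊆ s) : IntegrableOn (fun y ↦ f y • ψ y) s := by
  have h : IntegrableOn (fun y ↦ f y • ψ y) (tsupport ψ) :=
    ((hf.mono hs).smul hψ.continuousOn).integrableOn_compact hc
  have h2 : Integrable (fun y ↦ f y • ψ y) :=
    (integrableOn_iff_integrable_of_support_subset
      ((Function.support_smul_subset_right f ψ).trans (subset_tsupport ψ))).mp h
  exact h2.integrableOn

theorem norm_integral_averagedVerticalMeasure_sub_le {k : ℕ} {ι : Type*} [Fintype ι]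
    (B : Module.Basis ι ℂ (CuspForm 𝒮ℒ (k : ℤ))) (x : ℝ) {ψ : ℝ → ℂ} (hψ : Continuous ψ)
    (hc : HasCompactSupport ψ) {a b R : ℝ} (ha : 0 < a) (hs : tsupport ψ ⊆ Ioo a b) (c : ℝ)
    (hR : 0 ≤ R)
    (h : ∫⁻ y in Ioo a b, ENNReal.ofReal (|averagedDensity B x y - c| * (1 / y)) ≤
      ENNReal.ofReal R) :
    ‖(∫ y, ψ y ∂averagedVerticalMeasure B x) - (c : ℂ) * ∫ y, ψ y ∂multiplicativeMeasure‖ ≤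
      (⨆ y, ‖ψ y‖) * R := by
  have hsub : Ioo a b ⊆ Ioi 0 := fun y hy ↦ ha.trans hy.1
  have hinv : ContinuousOn (fun y : ℝ ↦ 1 / y) (Ioi 0) :=
    continuousOn_const.div continuousOn_id fun y hy ↦ (ne_of_gt hy)
  have hd := continuousOn_averagedDensity B x
  -- Needed because a real supremum over an unbounded family is 0 by convention.
  have hb : BddAbove (range fun y ↦ ‖ψ y‖) :=
    hψ.norm.bddAbove_range_of_hasCompactSupport hc.norm
  have hM0 : 0 ≤ ⨆ y, ‖ψ y‖ := Real.iSup_nonneg fun y ↦ norm_nonneg _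
  have i1 := integrableOn_smul_of_tsupport_subset (hinv.mul hd) hψ hc (hs.trans hsub)
  have i2 := integrableOn_smul_of_tsupport_subset (hinv.mul (continuousOn_const (c := c))) hψ hc
    (hs.trans hsub)
  have e1 : (∫ y, ψ y ∂averagedVerticalMeasure B x) -
      (c : ℂ) * ∫ y, ψ y ∂multiplicativeMeasure =
      ∫ y in Ioo a b, ((averagedDensity B x y - c) * (1 / y)) • ψ y := by
    rw [integral_averagedVerticalMeasure, integral_multiplicativeMeasure, ← integral_const_mul]
    calc _ = (∫ y in Ioi 0, (1 / y * averagedDensity B x y) • ψ y) -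
          ∫ y in Ioi 0, (1 / y * c) • ψ y := by
          congr 1
          · simp only [smul_smul]
          · refine integral_congr_ae (ae_of_all _ fun y ↦ ?_)
            simp only [Complex.real_smul]
            push_cast
            ring
      _ = ∫ y in Ioi 0, ((averagedDensity B x y - c) * (1 / y)) • ψ y := by
          refine (integral_sub i1 i2).symm.trans ?_
          refine integral_congr_ae (ae_of_all _ fun y ↦ ?_)
          simp only [Pi.mul_apply, ← sub_smul]
          congr 1
          ring
      _ = _ := by
          refine setIntegral_eq_of_subset_of_forall_sdiff_eq_zero measurableSet_Ioi hsub
            fun y hy ↦ ?_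
          rw [image_eq_zero_of_notMem_tsupport fun h ↦ hy.2 (hs h), smul_zero]
  rw [e1, mul_comm _ R]
  refine (norm_integral_le_lintegral_norm _).trans ?_
  refine ENNReal.toReal_le_of_le_ofReal (by positivity) ?_
  calc _ ≤ ∫⁻ y in Ioo a b, ENNReal.ofReal (|averagedDensity B x y - c| * (1 / y)) *
        ENNReal.ofReal (⨆ y, ‖ψ y‖) := by
        refine setLIntegral_mono' measurableSet_Ioo fun y hy ↦ ?_
        have hy0 : 0 ≤ 1 / y := (one_div_pos.mpr (hsub hy)).le
        rw [← ENNReal.ofReal_mul (by positivity), norm_smul, norm_mul, Real.norm_eq_abs,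
          Real.norm_of_nonneg hy0]
        refine ENNReal.ofReal_le_ofReal ?_
        gcongr
        exact le_ciSup hb y
    _ ≤ ENNReal.ofReal R * ENNReal.ofReal (⨆ y, ‖ψ y‖) := by
        rw [lintegral_mul_const' _ _ ENNReal.ofReal_ne_top]
        gcongr
    _ = _ := (ENNReal.ofReal_mul hR).symm

end

theorem theorem1 :
    ∃ (A₀ Y₀ C : ℝ) (k₀ : ℕ), 0 < A₀ ∧ 0 < Y₀ ∧ 0 < C ∧
      ∀ (A Y : ℝ) (k : ℕ), A₀ ≤ A → Y₀ ≤ Y → k₀ ≤ k → Even k →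
      ∀ (ι : Type) [Fintype ι] (B : Module.Basis ι ℂ (CuspForm 𝒮ℒ (k : ℤ))),
        IsPeterssonOrthonormal B →
      ∀ (x : ℝ) (ψ : ℝ → ℂ), ContDiff ℝ ∞ ψ → HasCompactSupport ψ →
        tsupport ψ ⊆ Set.Ioo Y⁻¹
          ((k : ℝ) ^ (1 / 2 : ℝ) * (17 * A * Real.log k) ^ (-(1 / 2) : ℝ)) →
        ‖(∫ y, ψ y ∂(averagedVerticalMeasure B x))
            - ((3 / Real.pi : ℝ) : ℂ) * ∫ y, ψ y ∂multiplicativeMeasure‖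
          ≤ C * ((⨆ y, ‖ψ y‖) * Y ^ 2 * (k : ℝ) ^ (-(1 / 2) : ℝ)
              * (Real.log k) ^ (1 / 2 : ℝ)) := by
  obtain ⟨C, hC, hCb⟩ := exists_setLIntegral_averagedDensity_sub_le
  -- A₀ = 2 turns 17A into at least 34, Y₀ = 1 allows Y ≤ Y², and 256 = 2 · 128 matches `128 ≤ m`.
  refine ⟨2, 1, C, 256, by norm_num, by norm_num, hC,
    fun A Y k hA hY hk hke ι _ B hB x ψ hψ hc hs ↦ ?_⟩
  obtain ⟨m, rfl⟩ := hke.two_dvd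
  have hkR : (256 : ℝ) ≤ ((2 * m : ℕ) : ℝ) := by exact_mod_cast hk
  have hlog : 1 ≤ Real.log ((2 * m : ℕ) : ℝ) := by
    rw [Real.le_log_iff_exp_le (by linarith)]
    linarith [Real.exp_one_lt_d9]
  have hAl : 0 < 17 * A * Real.log ((2 * m : ℕ) : ℝ) := by
    have : 0 < A := by linarith
    positivity
  set T : ℝ := ((2 * m : ℕ) : ℝ) ^ (1 / 2 : ℝ) *
    (17 * A * Real.log ((2 * m : ℕ) : ℝ)) ^ (-(1 / 2) : ℝ) with hT
  have hT2 : T ^ 2 ≤ (2 * m) / (34 * Real.log (2 * m)) := by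
    rw [hT, Real.rpow_neg hAl.le, ← Real.sqrt_eq_rpow, ← Real.sqrt_eq_rpow, mul_pow, inv_pow,
      Real.sq_sqrt (by linarith), Real.sq_sqrt hAl.le, ← div_eq_mul_inv]
    push_cast at hlog hkR ⊢
    gcongr
    linarith
  have hb := hCb m x Y T (by omega) hY (by positivity) hT2 ι B hB
  have hM0 : 0 ≤ ⨆ y, ‖ψ y‖ := Real.iSup_nonneg fun y ↦ norm_nonneg _
  refine (norm_integral_averagedVerticalMeasure_sub_le B x hψ.continuous hc
    (inv_pos.mpr (by linarith)) hs (3 / Real.pi) (by positivity) hb).trans ?_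
  have hsqrt : ((2 * m : ℕ) : ℝ) ^ (-(1 / 2) : ℝ) = (Real.sqrt (2 * m))⁻¹ := by
    rw [Real.rpow_neg (by positivity), ← Real.sqrt_eq_rpow]
    push_cast
    rfl
  -- The bound already holds without the logarithm, which enters only as a factor at least 1.
  have hl2 : 1 ≤ Real.log ((2 * m : ℕ) : ℝ) ^ (1 / 2 : ℝ) :=
    Real.one_le_rpow hlog (by norm_num)
  rw [hsqrt]
  calc (⨆ y, ‖ψ y‖) * (C * (Y ^ 2 / Real.sqrt (2 * m))) =
        C * ((⨆ y, ‖ψ y‖) * Y ^ 2 * (Real.sqrt (2 * m))⁻¹ * 1) := by ring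
    _ ≤ _ := by gcongr
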